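/- Let $A\in\mathbb{R}^{n\times n}$, $B\in\mathbb{R}^{n\times m}$ be a controllable pair, i.e. $\operatorname{rank}[B,AB,\dots,A^{n-1}B]=n$, and let $T>0$, $\tau>0$. Let $G_0\in\mathbb{R}^{n\times n}$, $Y_0\in\mathbb{R}^{m\times n}$ satisfy $$AG_0-G_0A+BY_0=A,\qquad G_0B=0,$$ with $G_0-I_n$ invertible and all eigenvalues of $G_{\mathbf d}:=I_n-G_0$ having positive real part. Put $K_0=Y_0(G_0-I_n)^{-1}$, $A_0=A+BK_0$, and let $X\in\mathbb{R}^{n\times n}$, $Y\in\mathbb{R}^{m\times n}$ satisfy $$A_0X+XA_0^{\top}+BY+Y^{\top}B^{\top}+G_{\mathbf d}X+XG_{\mathbf d}^{\top}=0,\qquad G_{\mathbf d}X+XG_{\mathbf d}^{\top}\succ0,\qquad X=X^{\top}\succ0 .$$ Put $K=YX^{-1}$, $\mathbf d(s)=e^{sG_{\mathbf d}}$ and $\|x\|=\sqrt{x^{\top}\mathbf d(-\ln T)^{\top}X^{-1}\mathbf d(-\ln T)x}$ for $x\in\mathbb{R}^n$. Let $\|0\|_{\mathbf d}=0$ and, for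 $x\ne0$, let $\|x\|_{\mathbf d}=e^{s}$, where $s$ is the unique real number with $\|\mathbf d(-s)x\|=1$. For $y,y_0\in\mathbb{R}^n$ let $$u_{\rm ct}(y,y_0)=K_0y+K\mathbf d(-\ln T)\,\mathbf d\!\left(-\ln\min\{1,\|y/\|y_0\|\|_{\mathbf d}\}\right)y\quad (y\neq 0,\ y_0\ne0),\qquad u_{\rm ct}(y,0)=(K_0+K\mathbf d(-\ln T))y,$$ and let $\bar u_{\rm ct}(y,y_0)=\{u_{\rm ct}(y,y_0)\}$ if $y\ne0$ and $\bar u_{\rm ct}(0,y_0)=\|y_0\|\,K\mathbf d(-\ln T)\{b\in\mathbb{R}^n:\|b\|\le1\}$. For $x_0\in\mathbb{R}^n$, a solution of the closed-loop input-delay system with zero initial control is a tuple $(x,y,u)\in W^{1,\infty}_{\rm loc}([0,\infty),\mathbb{R}^n)\times W^{1,\infty}_{\rm loc}([0,\infty),\mathbb{R}^n)\times L^{\infty}_{\rm loc}([-\tau,\infty),\mathbb{R}^m)$ such that $x(0)=x_0$, $u=0$ a.e. on $(-\tau,0)$, $$\dot x(t)=Ax(t)+Bu(t-\tau)\quad\text{and}\quad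 u(t)\in\bar u_{\rm ct}(y(t),y(0))\quad\text{for almost every }t>0,$$ $$y(t)=e^{A\tau}x(t)+\int_{-\tau}^{0}e^{-A\theta}Bu(t+\theta)\,d\theta\quad\text{for all }t\ge0 .$$ Then the closed-loop system is fixed-time stable with the constant settling time $T+\tau$, namely: 1. for every $x_0\in\mathbb{R}^n$ a solution exists; 2. there is a continuous strictly increasing function $\alpha:[0,\infty)\to[0,\infty)$ with $\alpha(0)=0$ such that for every $x_0\in\mathbb{R}^n$ every solution satisfies $\|x(t)\|\le\alpha(\|x_0\|)$ for all $t\ge0$ (Lyapunov stability); 3. for every $x_0\in\mathbb{R}^n$ every solution satisfies $x(t)=0$ for all $t\ge T+\tau$, and, if $x_0\ne0$, $x(t)\ne0$ for all $t\in[0,T+\tau)$. -/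

import Mathlib

open MeasureTheory Set
open scoped Matrix ENNReal

noncomputable section

namespace DelayControl

variable {n m : ℕ}

/-- The pair `{A, B}` is controllable: the Kalman matrix `[B, AB, …, Aⁿ⁻¹B]` has rank `n`.
The column with index `(k, j)` is the `j`-th column of `Aᵏ B`. -/
def Controllable (A : Matrix (Fin n) (Fin n) ℝ) (B : Matrix (Fin n) (Fin m) ℝ) : Prop :=
  (Matrix.of fun (i : Fin n) (kj : Fin n × Fin m) => (A ^ (kj.1 : ℕ) * B) i kj.2).rank = n

/-- All (complex) eigenvalues of the real matrix `G` have positive real part. -/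
def AntiHurwitz (G : Matrix (Fin n) (Fin n) ℝ) : Prop :=
  ∀ z ∈ spectrum ℂ (G.map Complex.ofReal), 0 < z.re

/-- The comparison class `𝒦`: continuous strictly increasing functions `[0, ∞) → [0, ∞)`
vanishing at `0`. -/
def ClassK (α : ℝ → ℝ) : Prop :=
  ContinuousOn α (Ici 0) ∧ StrictMonoOn α (Ici 0) ∧ α 0 = 0

/-- The matrices from which the feedback is built. -/
structure Design (n m : ℕ) where
  G₀ : Matrix (Fin n) (Fin n) ℝ
  Y₀ : Matrix (Fin m) (Fin n) ℝ
  X : Matrix (Fin n) (Fin n) ℝ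
  Y : Matrix (Fin m) (Fin n) ℝ

namespace Design

variable (p : Design n m)

/-- The generator `G_d = I + μ G₀` of the dilation, for the homogeneity degree `μ = -1`. -/
def Gd : Matrix (Fin n) (Fin n) ℝ := 1 + (-1 : ℝ) • p.G₀

/-- The gain `K₀ = Y₀ (G₀ - I)⁻¹`. -/
def K₀ : Matrix (Fin m) (Fin n) ℝ := p.Y₀ * (p.G₀ - 1)⁻¹

/-- The gain `K = Y X⁻¹`. -/
def K : Matrix (Fin m) (Fin n) ℝ := p.Y * p.X⁻¹

/-- The dilation `d(s) = exp (s G_d)`. -/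
def dil (s : ℝ) : Matrix (Fin n) (Fin n) ℝ := NormedSpace.exp (s • p.Gd)

/-- The weighted Euclidean norm `‖x‖ = √(xᵀ d(-ln T)ᵀ X⁻¹ d(-ln T) x)`. -/
def wnorm (T : ℝ) (x : Fin n → ℝ) : ℝ :=
  √(x ⬝ᵥ (((p.dil (-Real.log T))ᵀ * p.X⁻¹ * p.dil (-Real.log T)) *ᵥ x))

open Classical in
/-- The canonical homogeneous norm induced by `wnorm`: `‖0‖_d = 0`, and for `x ≠ 0`
`‖x‖_d = eˢ`, where `s` is the real number such that `‖d(-s) x‖ = 1` (it exists and is unique for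
the admissible designs below; for `x = 0` there is no such `s`). -/
def homNorm (T : ℝ) (x : Fin n → ℝ) : ℝ :=
  if h : ∃ s : ℝ, p.wnorm T (p.dil (-s) *ᵥ x) = 1 then Real.exp h.choose else 0

/-- The conditions on the design matrices for the pair `{A, B}`; here
`A₀ = A + B Y₀ (G₀ - I)⁻¹ = A + B K₀`. -/
structure Admissible (A : Matrix (Fin n) (Fin n) ℝ) (B : Matrix (Fin n) (Fin m) ℝ) : Prop where
  gen_eq : A * p.G₀ - p.G₀ * A + B * p.Y₀ = A
  gen_mul_B : p.G₀ * B = 0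
  antiHurwitz : AntiHurwitz p.Gd
  isUnit : IsUnit (p.G₀ - 1)
  lmi_eq : (A + B * p.K₀) * p.X + p.X * (A + B * p.K₀)ᵀ + B * p.Y + p.Yᵀ * Bᵀ
    + p.Gd * p.X + p.X * p.Gdᵀ = 0
  lmi_pos : (p.Gd * p.X + p.X * p.Gdᵀ).PosDef
  posDef : p.X.PosDef

open Classical in
/-- The single-valued feedback (used for `y ≠ 0`):
`u_ct(y, y₀) = K₀ y + K d(-ln T) d(-ln min {1, ‖y/‖y₀‖‖_d}) y` for `y₀ ≠ 0`, and
`u_ct(y, 0) = (K₀ + K d(-ln T)) y`. -/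
def uct (T : ℝ) (y y₀ : Fin n → ℝ) : Fin m → ℝ :=
  if y₀ = 0 then (p.K₀ + p.K * p.dil (-Real.log T)) *ᵥ y
  else p.K₀ *ᵥ y + (p.K * p.dil (-Real.log T) *
    p.dil (-Real.log (min 1 (p.homNorm T ((p.wnorm T y₀)⁻¹ • y))))) *ᵥ y

/-- The set-valued (Filippov) regularization of the feedback: `{u_ct(y, y₀)}` for `y ≠ 0`, and
`‖y₀‖ K d(-ln T) 𝓑` for `y = 0`, where `𝓑` is the closed unit ball of `wnorm`. -/
def uctBar (T : ℝ) (y y₀ : Fin n → ℝ) : Set (Fin m → ℝ) :=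
  {v | (y ≠ 0 ∧ v = p.uct T y y₀) ∨
    (y = 0 ∧ ∃ b : Fin n → ℝ, p.wnorm T b ≤ 1 ∧
      v = p.wnorm T y₀ • ((p.K * p.dil (-Real.log T)) *ᵥ b))}

end Design

/-- `x ∈ W^{1,∞}_loc([0, ∞), ℝⁿ)`: absolutely continuous with essentially bounded derivative on
every bounded interval `[0, R]`. -/
def W1InfLoc (x : ℝ → Fin n → ℝ) : Prop :=
  ∀ R : ℝ, 0 < R → AbsolutelyContinuousOnInterval x 0 R ∧
    MemLp (deriv x) ∞ (volume.restrict (Ioo 0 R))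

/-- `(x, y, u)` is a solution of the closed-loop system with input delay `τ`, initial state `x₀`
and initial control `φ` on `(-τ, 0)`. -/
structure IsSolution (A : Matrix (Fin n) (Fin n) ℝ) (B : Matrix (Fin n) (Fin m) ℝ)
    (p : Design n m) (T τ : ℝ) (φ : ℝ → Fin m → ℝ) (x₀ : Fin n → ℝ)
    (x y : ℝ → Fin n → ℝ) (u : ℝ → Fin m → ℝ) : Prop where
  x_reg : W1InfLoc x
  y_reg : W1InfLoc y
  u_reg : ∀ R : ℝ, MemLp u ∞ (volume.restrict (Ioo (-τ) R))
  /-- The plant `ẋ(t) = A x(t) + B u(t - τ)` for almost every `t > 0`. -/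
  plant : ∀ᵐ t ∂(volume.restrict (Ioi (0 : ℝ))),
    HasDerivAt x (A *ᵥ x t + B *ᵥ u (t - τ)) t
  x_init : x 0 = x₀
  u_init : ∀ᵐ θ ∂(volume.restrict (Ioo (-τ) 0)), u θ = φ θ
  /-- The predictor variable (Artstein's transformation). -/
  predictor : ∀ t : ℝ, 0 ≤ t →
    y t = NormedSpace.exp (τ • A) *ᵥ x t +
      ∫ θ in (-τ)..0, NormedSpace.exp ((-θ) • A) *ᵥ (B *ᵥ u (t + θ))
  /-- The feedback `u(t) ∈ ū_ct(y(t), y₀)`, with `y₀ = y(0)`, for almost every `t > 0`. -/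
  feedback : ∀ᵐ t ∂(volume.restrict (Ioi (0 : ℝ))), u t ∈ p.uctBar T (y t) (y 0)

end DelayControl

end

/-!
The delay disappears in the predictor variable: variation of constants identifies `y(t)` with
`x(t + τ)` (`IsSolution.y_eq_shift`). Hence `y` solves the delay-free inclusion
`ẏ ∈ A y + B ū_ct(y, y(0))`, while on `[0, τ]` the zero initial control gives `x(t) = e^{tA} x₀`.
Everything reduces to showing that, for `y(0) ≠ 0`, one has `‖y(t)‖ ≤ ‖y(0)‖` and `y(t) = 0`
exactly for `t ≥ T`.

*Homogeneity.* The equations `A G₀ - G₀ A + B Y₀ = A` and `G₀ B = 0` give `d(s) B = eˢ B` and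
`d(s) A₀ = eˢ A₀ d(s)` for `A₀ = A + B K₀` (`dil_mul_B`, `dil_mul_A₀`). Put `z = y / ‖y(0)‖` and
`π = d(-σ) z`, where `e^σ = T ‖z‖_d`, so that `πᵀ X⁻¹ π = 1`. As long as `0 < ‖z‖_d ≤ 1`, the
closed loop in this variable is `π' = e^{-σ} (A₀ + B K) π - σ' G_d π`. The conditions on
`X` and `Y` say that `X⁻¹ (A₀ + B K) + X⁻¹ G_d` is skew-symmetric (`lyapunov_loop`) and that
`X⁻¹ G_d + G_dᵀ X⁻¹` is positive definite. Differentiating `πᵀ X⁻¹ π = 1` therefore forces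
`σ' = -e^{-σ}`, that is, `‖z‖_d` decreases with the constant slope `-1/T` (`hasDerivAt_homNorm`).

*Arbitrary solutions.* Where `y ≠ 0` the feedback is continuous in `y`, so an absolutely continuous
solution is classically differentiable there (`hasDerivAt_of_sub_eq_integral`) and no chain rule for
absolutely continuous functions is needed. The norm `‖z‖` cannot grow beyond `1`, since for
`‖z‖ ≥ 1` the feedback is linear and `‖z‖` does not increase. Hence `‖z(t)‖_d` is continuous on
`[0, ∞)`, starts at `1` and has slope `-1/T` wherever it is positive, so it equals `max (1 - t/T) 0`
(`homNorm_trajectory`). If `y(0) = 0` the feedback is linear and `y = 0`.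

*Existence.* The same change of variables linearises the closed loop: with `r = ln (T - t)`,
`d(-r) y` moves, in the time `-r`, along the flow of the matrix `M = A₀ + B K + G_d`, which
preserves the quadratic form of `X⁻¹`. So `y(t) = d(r) e^{(ln T - r) M} d(-ln T) y(0)` on `[0, T)`,
continued by `0`, and a delayed copy of this orbit, preceded by `e^{tA} x₀`, is a solution
(`exists_isSolution`).
-/

noncomputable section

namespace DelayControl

/-! ### The flow of a linear vector field -/

variable {k l : ℕ}

/-- A square matrix as a continuous linear endomorphism of `ℝᵏ`. Matrices carry no global norm, so
calculus with the matrix exponential is transported to this Banach algebra. -/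
def toCLM : Matrix (Fin k) (Fin k) ℝ ≃ₐ[ℝ] ((Fin k → ℝ) →L[ℝ] (Fin k → ℝ)) :=
  (Matrix.toLinAlgEquiv' (R := ℝ)).trans (Module.End.toContinuousLinearMap (𝕜 := ℝ) (Fin k → ℝ))

@[simp]
theorem toCLM_apply (M : Matrix (Fin k) (Fin k) ℝ) (v : Fin k → ℝ) : toCLM M v = M *ᵥ v := rfl

theorem continuous_toCLM_symm : Continuous (toCLM (k := k)).symm :=
  (toCLM (k := k)).symm.toLinearMap.continuous_of_finiteDimensional

theorem toCLM_exp (M : Matrix (Fin k) (Fin k) ℝ) :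
    toCLM (NormedSpace.exp M) = NormedSpace.exp (toCLM M) := by
  have h := (NormedSpace.exp_series_hasSum_exp' (𝕂 := ℝ) (toCLM M)).map (toCLM (k := k)).symm
    continuous_toCLM_symm
  rw [← (toCLM (k := k)).apply_symm_apply (NormedSpace.exp (toCLM M)), ← h.tsum_eq,
    NormedSpace.exp_eq_tsum ℝ]
  simp

theorem exp_mulVec (M : Matrix (Fin k) (Fin k) ℝ) (v : Fin k → ℝ) :
    NormedSpace.exp M *ᵥ v = NormedSpace.exp (toCLM M) v := by
  rw [← toCLM_exp, toCLM_apply]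

theorem exp_mul_intertwine {G : Matrix (Fin k) (Fin k) ℝ} {H : Matrix (Fin l) (Fin l) ℝ}
    {C : Matrix (Fin k) (Fin l) ℝ} (h : G * C = C * H) :
    NormedSpace.exp G * C = C * NormedSpace.exp H := by
  have hp : ∀ i : ℕ, G ^ i * C = C * H ^ i := by
    intro i
    induction i with
    | zero => simp
    | succ i ih => rw [pow_succ, Matrix.mul_assoc, h, ← Matrix.mul_assoc, ih, pow_succ,
        Matrix.mul_assoc]
  have hs : ∀ {j : ℕ} (M : Matrix (Fin j) (Fin j) ℝ),
      HasSum (fun i : ℕ => ((i.factorial : ℝ)⁻¹) • M ^ i) (NormedSpace.exp M) := by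
    intro j M
    have h := (NormedSpace.exp_series_hasSum_exp' (𝕂 := ℝ) (toCLM M)).map (toCLM (k := j)).symm
      continuous_toCLM_symm
    rw [← toCLM_exp] at h
    simpa [Function.comp_def] using h
  have h1 := (hs G).map (Matrix.addMonoidHomMulRight C) (continuous_id.matrix_mul continuous_const)
  have h2 := (hs H).map (Matrix.addMonoidHomMulLeft C) (continuous_const.matrix_mul continuous_id)
  have h3 : (Matrix.addMonoidHomMulRight C) ∘ (fun i : ℕ => ((i.factorial : ℝ)⁻¹) • G ^ i) =
      (Matrix.addMonoidHomMulLeft C) ∘ (fun i : ℕ => ((i.factorial : ℝ)⁻¹) • H ^ i) := by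
    funext i
    simp [Matrix.addMonoidHomMulRight, Matrix.addMonoidHomMulLeft, hp]
  rw [h3] at h1
  exact h1.unique h2

theorem exp_smul_one (s : ℝ) : NormedSpace.exp (s • (1 : Matrix (Fin k) (Fin k) ℝ)) =
    Real.exp s • (1 : Matrix (Fin k) (Fin k) ℝ) := by
  rw [Matrix.smul_one_eq_diagonal, Matrix.exp_diagonal, Matrix.smul_one_eq_diagonal]
  congr 1
  funext i
  rw [Pi.coe_exp, ← Real.exp_eq_exp_ℝ]

theorem exp_smul_add (M : Matrix (Fin k) (Fin k) ℝ) (s t : ℝ) :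
    NormedSpace.exp ((s + t) • M) = NormedSpace.exp (s • M) * NormedSpace.exp (t • M) := by
  rw [add_smul]
  exact Matrix.exp_add_of_commute _ _ (((Commute.refl M).smul_left s).smul_right t)

theorem hasFDerivAt_exp_smul_mulVec {E : Type*} [NormedAddCommGroup E] [NormedSpace ℝ E]
    (M : Matrix (Fin k) (Fin k) ℝ) {g : E → ℝ} {g' : E →L[ℝ] ℝ} {v : E → Fin k → ℝ}
    {v' : E →L[ℝ] (Fin k → ℝ)} {e : E} (hg : HasFDerivAt g g' e) (hv : HasFDerivAt v v' e) :
    HasFDerivAt (fun e => NormedSpace.exp (g e • M) *ᵥ v e)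
      (g'.smulRight (M *ᵥ (NormedSpace.exp (g e • M) *ᵥ v e)) +
        (toCLM (NormedSpace.exp (g e • M))).comp v') e := by
  have h0 := hasDerivAt_exp_smul_const' (𝕂 := ℝ) (toCLM M) (g e)
  have h1 := h0.hasFDerivAt.comp e hg
  have h2 := h1.clm_apply hv
  simp only [Function.comp_apply, ← map_smul, ← toCLM_exp, toCLM_apply] at h2
  refine h2.congr_fderiv ?_
  ext1 h
  simp [add_comm, ← map_mul]

theorem hasDerivAt_exp_smul_mulVec
    (M : Matrix (Fin k) (Fin k) ℝ) {g : ℝ → ℝ} {g' : ℝ} {v : ℝ → Fin k → ℝ}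
    {v' : Fin k → ℝ} {e : ℝ} (hg : HasDerivAt g g' e) (hv : HasDerivAt v v' e) :
    HasDerivAt (fun e => NormedSpace.exp (g e • M) *ᵥ v e)
      (g' • (M *ᵥ (NormedSpace.exp (g e • M) *ᵥ v e)) + NormedSpace.exp (g e • M) *ᵥ v') e := by
  simpa using (hasFDerivAt_exp_smul_mulVec M hg.hasFDerivAt hv.hasFDerivAt).hasDerivAt

theorem continuous_exp_smul (M : Matrix (Fin k) (Fin k) ℝ) :
    Continuous fun t : ℝ => NormedSpace.exp (t • M) := by
  have h := continuous_toCLM_symm.comp (differentiable_exp_smul_const ℝ (toCLM M)).continuous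
  refine h.congr fun t => ?_
  simp [← map_smul, ← toCLM_exp]

theorem _root_.AbsolutelyContinuousOnInterval.clm_apply {E F : Type*} [NormedAddCommGroup E]
    [NormedSpace ℝ E] [NormedAddCommGroup F] [NormedSpace ℝ F] {f : ℝ → E →L[ℝ] F} {g : ℝ → E}
    {a b : ℝ}
    (hf : AbsolutelyContinuousOnInterval f a b) (hg : AbsolutelyContinuousOnInterval g a b) :
    AbsolutelyContinuousOnInterval (fun t => f t (g t)) a b := by
  obtain ⟨C, hC⟩ := hf.exists_bound
  obtain ⟨D, hD⟩ := hg.exists_bound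
  unfold AbsolutelyContinuousOnInterval at hf hg
  apply squeeze_zero' ?_ ?_
    (by simpa using (hg.const_mul C).add (hf.const_mul D))
  · exact Filter.Eventually.of_forall <| fun _ ↦ Finset.sum_nonneg (fun i hi ↦ dist_nonneg)
  rw [Filter.eventually_inf_principal]
  filter_upwards with (n, I) hnI
  simp only [Finset.mul_sum, ← Finset.sum_add_distrib]
  gcongr with i hi
  have hI := hnI.left i hi
  have h1 := hC _ hI.1
  have h2 := hD _ hI.2
  have : f (I i).1 (g (I i).1) - f (I i).2 (g (I i).2) =
      f (I i).1 (g (I i).1 - g (I i).2) + (f (I i).1 - f (I i).2) (g (I i).2) := by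
    simp
  rw [dist_eq_norm, dist_eq_norm, dist_eq_norm, this]
  refine (norm_add_le _ _).trans (add_le_add ?_ ?_)
  · exact ((f (I i).1).le_opNorm _).trans (by gcongr)
  · rw [mul_comm]
    exact ((f (I i).1 - f (I i).2).le_opNorm _).trans (by gcongr)

/-- Variation of constants for an absolutely continuous (Carathéodory) solution. Integrability of
the integrand needs no hypothesis: it is the derivative of an absolutely continuous function. -/
theorem variation_of_constants (M : Matrix (Fin k) (Fin k) ℝ) {x w : ℝ → Fin k → ℝ} {a b : ℝ}
    (hab : a ≤ b) (hx : AbsolutelyContinuousOnInterval x a b)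
    (hd : ∀ᵐ t, t ∈ Ioc a b → HasDerivAt x (M *ᵥ x t + w t) t) :
    x b = NormedSpace.exp ((b - a) • M) *ᵥ x a +
      ∫ s in a..b, NormedSpace.exp ((b - s) • M) *ᵥ w s := by
  -- The homogeneous flow cancels the drift in `h(s) = e^{(b-s)M} x(s)`.
  set h : ℝ → Fin k → ℝ := fun s => NormedSpace.exp ((b - s) • M) *ᵥ x s with hh
  have hAC : AbsolutelyContinuousOnInterval h a b := by
    have h1 : AbsolutelyContinuousOnInterval
        (fun s : ℝ => NormedSpace.exp ((b - s) • toCLM M)) a b := by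
      have : ContDiff ℝ 1 (NormedSpace.exp : ((Fin k → ℝ) →L[ℝ] (Fin k → ℝ)) → _) :=
        contDiff_iff_contDiffAt.2 fun x => (NormedSpace.exp_analytic (𝕂 := ℝ) x).contDiffAt
      exact ((this.comp ((contDiff_const.sub contDiff_id).smul contDiff_const)).contDiffOn
        ).absolutelyContinuousOnInterval
    have h2 := h1.clm_apply hx
    simp only [← map_smul, ← toCLM_exp, toCLM_apply] at h2
    exact h2
  have hder : ∀ᵐ t, t ∈ Ioc a b → HasDerivAt h (NormedSpace.exp ((b - t) • M) *ᵥ w t) t := by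
    filter_upwards [hd] with t ht hmem
    have h1 := hasDerivAt_exp_smul_mulVec M ((hasDerivAt_id t).const_sub b) (ht hmem)
    have h2 : M *ᵥ (NormedSpace.exp ((b - t) • M) *ᵥ x t) =
        NormedSpace.exp ((b - t) • M) *ᵥ (M *ᵥ x t) := by
      rw [Matrix.mulVec_mulVec, Matrix.mulVec_mulVec, exp_mul_intertwine (H := (b - t) • M)]
      simp
    simpa [h2, Matrix.mulVec_add] using h1
  have hcoord : ∀ i, AbsolutelyContinuousOnInterval (fun s => h s i) a b := by
    intro i
    have h1 : AbsolutelyContinuousOnInterval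
        (fun _ : ℝ => ContinuousLinearMap.proj (R := ℝ) (φ := fun _ : Fin k => ℝ) i) a b :=
      contDiffOn_const.absolutelyContinuousOnInterval
    have h2 := h1.clm_apply hAC
    simp only [ContinuousLinearMap.proj_apply] at h2
    exact h2
  have hdi : ∀ i, ∀ᵐ t, t ∈ uIoc a b →
      deriv (fun s => h s i) t = (NormedSpace.exp ((b - t) • M) *ᵥ w t) i := by
    intro i
    filter_upwards [hder] with t ht hmem
    rw [uIoc_of_le hab] at hmem
    exact (hasDerivAt_pi.1 (ht hmem) i).deriv
  have hint : ∀ i, Integrable (fun t => (NormedSpace.exp ((b - t) • M) *ᵥ w t) i)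
      (volume.restrict (Ioc a b)) := by
    intro i
    have h1 := ((hcoord i).intervalIntegrable_deriv.congr_ae
      ((ae_restrict_iff' measurableSet_uIoc).2 (hdi i)))
    exact (intervalIntegrable_iff_integrableOn_Ioc_of_le hab).1 h1
  have key : h b - h a = ∫ s in a..b, NormedSpace.exp ((b - s) • M) *ᵥ w s := by
    funext i
    have h1 := (hcoord i).integral_deriv_eq_sub
    rw [intervalIntegral.integral_congr_ae (hdi i)] at h1
    rw [intervalIntegral.integral_of_le hab, eval_integral hint, Pi.sub_apply, ← h1,
      intervalIntegral.integral_of_le hab]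
  rw [← key]
  simp [hh]

/-! ### Quadratic forms and the algebra of the dilation -/

theorem hasFDerivAt_dotProduct {E : Type*} [NormedAddCommGroup E] [NormedSpace ℝ E]
    {v w : E → Fin k → ℝ} {v' w' : E →L[ℝ] (Fin k → ℝ)} {e : E}
    (hv : HasFDerivAt v v' e) (hw : HasFDerivAt w w' e) :
    HasFDerivAt (fun e => v e ⬝ᵥ w e)
      (∑ i, (v e i • (ContinuousLinearMap.proj (R := ℝ) (φ := fun _ : Fin k => ℝ) i).comp w' +
        w e i • (ContinuousLinearMap.proj (R := ℝ) (φ := fun _ : Fin k => ℝ) i).comp v')) e := by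
  have hv' := hasFDerivAt_pi'.1 hv
  have hw' := hasFDerivAt_pi'.1 hw
  exact HasFDerivAt.fun_sum fun i _ => (hv' i).mul (hw' i)

/-- A positive continuous function that is homogeneous of degree two dominates every other one, by
compactness of the unit sphere. -/
theorem exists_le_mul_of_homogeneous {f g : (Fin k → ℝ) → ℝ} (hf : Continuous f)
    (hg : Continuous g) (hf2 : ∀ (r : ℝ) v, f (r • v) = r ^ 2 * f v)
    (hg2 : ∀ (r : ℝ) v, g (r • v) = r ^ 2 * g v) (hpos : ∀ v, v ≠ 0 → 0 < f v) :
    ∃ C : ℝ, 0 < C ∧ ∀ v, g v ≤ C * f v := by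
  have hne : ∀ v ∈ Metric.sphere (0 : Fin k → ℝ) 1, f v ≠ 0 := fun v hv =>
    (hpos v (ne_zero_of_mem_unit_sphere (⟨v, hv⟩ : Metric.sphere (0 : Fin k → ℝ) 1))).ne'
  obtain ⟨C, hC⟩ := (isCompact_sphere (0 : Fin k → ℝ) 1).bddAbove_image
    (hg.continuousOn.div hf.continuousOn hne)
  refine ⟨max C 1, by positivity, fun v => ?_⟩
  rcases eq_or_ne v 0 with rfl | hv
  · have h1 := hf2 0 0
    have h2 := hg2 0 0
    simp only [smul_zero] at h1 h2
    rw [h1, h2]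
    simp
  · have hnv : ‖v‖ ≠ 0 := norm_ne_zero_iff.2 hv
    have hu : ‖v‖⁻¹ • v ∈ Metric.sphere (0 : Fin k → ℝ) 1 := by
      simp [norm_smul, hnv]
    have h1 : g (‖v‖⁻¹ • v) / f (‖v‖⁻¹ • v) ≤ C := hC ⟨_, hu, rfl⟩
    rw [hf2, hg2, mul_div_mul_left _ _ (by positivity), div_le_iff₀ (hpos v hv)] at h1
    exact h1.trans (mul_le_mul_of_nonneg_right (le_max_left _ _) (hpos v hv).le)

/-- The quadratic form `vᵀ M v`. -/
def quadForm (M : Matrix (Fin k) (Fin k) ℝ) (v : Fin k → ℝ) : ℝ := v ⬝ᵥ (M *ᵥ v)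

theorem quadForm_smul (M : Matrix (Fin k) (Fin k) ℝ) (r : ℝ) (v : Fin k → ℝ) :
    quadForm M (r • v) = r ^ 2 * quadForm M v := by
  simp [quadForm, Matrix.mulVec_smul]
  ring

theorem continuous_quadForm (M : Matrix (Fin k) (Fin k) ℝ) : Continuous (quadForm M) := by
  unfold quadForm
  fun_prop

theorem quadForm_pos {M : Matrix (Fin k) (Fin k) ℝ} (hM : M.PosDef) {v : Fin k → ℝ} (hv : v ≠ 0) :
    0 < quadForm M v := by
  have h := hM.dotProduct_mulVec_pos hv
  rwa [star_trivial] at h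

theorem quadForm_zero (M : Matrix (Fin k) (Fin k) ℝ) : quadForm M 0 = 0 := by simp [quadForm]

theorem quadForm_nonneg {M : Matrix (Fin k) (Fin k) ℝ} (hM : M.PosDef) (v : Fin k → ℝ) :
    0 ≤ quadForm M v := by
  rcases eq_or_ne v 0 with rfl | hv
  · simp [quadForm]
  · exact (quadForm_pos hM hv).le

theorem quadForm_mul_add (M N : Matrix (Fin k) (Fin k) ℝ) (v : Fin k → ℝ) :
    quadForm (M * N + Nᵀ * M) v = (N *ᵥ v) ⬝ᵥ (M *ᵥ v) + v ⬝ᵥ (M *ᵥ (N *ᵥ v)) := by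
  rw [quadForm, Matrix.add_mulVec, dotProduct_add, add_comm]
  simp only [Matrix.mulVec_mulVec]
  congr 1
  rw [← Matrix.mulVec_mulVec, Matrix.dotProduct_mulVec, Matrix.vecMul_transpose]

theorem hasFDerivAt_quadForm_comp {E : Type*} [NormedAddCommGroup E] [NormedSpace ℝ E]
    (M : Matrix (Fin k) (Fin k) ℝ) {v : E → Fin k → ℝ} {v' : E →L[ℝ] (Fin k → ℝ)} {e : E}
    (hv : HasFDerivAt v v' e) :
    ∃ D : E →L[ℝ] ℝ, HasFDerivAt (fun e => quadForm M (v e)) D e ∧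
      ∀ h, D h = v' h ⬝ᵥ (M *ᵥ v e) + v e ⬝ᵥ (M *ᵥ v' h) := by
  have hM : HasFDerivAt (fun e => M *ᵥ v e) ((toCLM M).comp v') e :=
    (toCLM M).hasFDerivAt.comp e hv
  refine ⟨_, hasFDerivAt_dotProduct hv hM, fun h => ?_⟩
  simp [dotProduct, Finset.sum_add_distrib, add_comm, mul_comm]

theorem hasDerivAt_quadForm_comp (M : Matrix (Fin k) (Fin k) ℝ) {v : ℝ → Fin k → ℝ}
    {v' : Fin k → ℝ} {t : ℝ} (hv : HasDerivAt v v' t) :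
    HasDerivAt (fun t => quadForm M (v t)) (v' ⬝ᵥ (M *ᵥ v t) + v t ⬝ᵥ (M *ᵥ v')) t := by
  obtain ⟨D, hD, h⟩ := hasFDerivAt_quadForm_comp M hv.hasFDerivAt
  have := hD.hasDerivAt
  rw [h] at this
  simpa using this

namespace Design
variable {n m : ℕ} {p : Design n m} {A : Matrix (Fin n) (Fin n) ℝ} {B : Matrix (Fin n) (Fin m) ℝ}

theorem Admissible.posDef_inv (hp : p.Admissible A B) : (p.X⁻¹).PosDef := hp.posDef.inv

theorem Admissible.transpose_X (hp : p.Admissible A B) : p.Xᵀ = p.X := by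
  simpa using hp.posDef.isHermitian.eq

theorem Admissible.transpose_inv_X (hp : p.Admissible A B) : (p.X⁻¹)ᵀ = p.X⁻¹ := by
  rw [Matrix.transpose_nonsing_inv, hp.transpose_X]

theorem Admissible.inv_mul_X (hp : p.Admissible A B) : p.X⁻¹ * p.X = 1 :=
  Matrix.nonsing_inv_mul _ ((Matrix.isUnit_iff_isUnit_det _).1 hp.posDef.isUnit)

theorem Admissible.X_mul_inv (hp : p.Admissible A B) : p.X * p.X⁻¹ = 1 :=
  Matrix.mul_nonsing_inv _ ((Matrix.isUnit_iff_isUnit_det _).1 hp.posDef.isUnit)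

/-- Conjugation by `X⁻¹` turns a Lyapunov expression in `X` into one in `X⁻¹`. -/
theorem Admissible.inv_mul_mul_inv (hp : p.Admissible A B) (M : Matrix (Fin n) (Fin n) ℝ) :
    p.X⁻¹ * (M * p.X + p.X * Mᵀ) * p.X⁻¹ = p.X⁻¹ * M + Mᵀ * p.X⁻¹ := by
  rw [Matrix.mul_add, Matrix.add_mul]
  congr 1
  · rw [Matrix.mul_assoc, Matrix.mul_assoc, hp.X_mul_inv, Matrix.mul_one]
  · rw [← Matrix.mul_assoc, hp.inv_mul_X, Matrix.one_mul]

/-- The matrix `X⁻¹ G_d + G_dᵀ X⁻¹`: its quadratic form is the rate at which the dilation `d`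
expands the quadratic form of `X⁻¹`. -/
def dissip (p : Design n m) : Matrix (Fin n) (Fin n) ℝ := p.X⁻¹ * p.Gd + p.Gdᵀ * p.X⁻¹

theorem Admissible.posDef_dissip (hp : p.Admissible A B) : p.dissip.PosDef := by
  rw [dissip, ← hp.inv_mul_mul_inv]
  have h := Matrix.PosDef.conjTranspose_mul_mul_same (B := p.X⁻¹) hp.lmi_pos ?_
  · simpa [hp.transpose_inv_X] using h
  · exact Matrix.mulVec_injective_of_isUnit hp.posDef_inv.isUnit

/-- The matrix `A + B K₀ + B K` of the linear closed loop. -/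
def loop (p : Design n m) (A : Matrix (Fin n) (Fin n) ℝ) (B : Matrix (Fin n) (Fin m) ℝ) :
    Matrix (Fin n) (Fin n) ℝ := A + B * p.K₀ + B * p.K

/-- The matrix equation of the design: `A + B K₀ + B K + G_d` is skew-symmetric with respect to
the inner product of `X⁻¹`. -/
theorem Admissible.lyapunov_loop (hp : p.Admissible A B) :
    p.X⁻¹ * p.loop A B + (p.loop A B)ᵀ * p.X⁻¹ = - p.dissip := by
  have hK : p.K * p.X = p.Y := by
    rw [K, Matrix.mul_assoc, hp.inv_mul_X, Matrix.mul_one]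
  have hK' : p.X * p.Kᵀ = p.Yᵀ := by
    rw [← hK, Matrix.transpose_mul, hp.transpose_X]
  have h : p.loop A B * p.X + p.X * (p.loop A B)ᵀ = -(p.Gd * p.X + p.X * p.Gdᵀ) := by
    rw [eq_neg_iff_add_eq_zero, ← hp.lmi_eq, ← hK']
    rw [loop, Matrix.transpose_add _ (B * p.K), Matrix.add_mul _ (B * p.K),
      Matrix.mul_add _ _ (B * p.K)ᵀ, Matrix.mul_assoc B p.K, hK, Matrix.transpose_mul B,
      Matrix.mul_assoc]
    abel
  rw [dissip, ← hp.inv_mul_mul_inv, ← hp.inv_mul_mul_inv, h, Matrix.mul_neg, Matrix.neg_mul]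

theorem Admissible.Gd_mul_B (hp : p.Admissible A B) : p.Gd * B = B := by
  simp [Gd, Matrix.add_mul, hp.gen_mul_B]

/-- Infinitesimal form of the homogeneity of degree `-1` of `A₀ = A + B K₀`. -/
theorem Admissible.Gd_mul_A₀ (hp : p.Admissible A B) :
    p.Gd * (A + B * p.K₀) = (A + B * p.K₀) * (p.Gd + 1) := by
  have hK : p.K₀ * (p.G₀ - 1) = p.Y₀ := by
    rw [K₀, Matrix.mul_assoc,
      Matrix.nonsing_inv_mul _ ((Matrix.isUnit_iff_isUnit_det _).1 hp.isUnit), Matrix.mul_one]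
  have h1 : p.G₀ * (A + B * p.K₀) = p.G₀ * A := by
    rw [Matrix.mul_add, ← Matrix.mul_assoc, hp.gen_mul_B, Matrix.zero_mul, add_zero]
  have h2 : (A + B * p.K₀) * (p.G₀ - 1) = p.G₀ * A := by
    rw [Matrix.add_mul, Matrix.mul_assoc, hK, Matrix.mul_sub, Matrix.mul_one]
    have := hp.gen_eq
    rw [sub_add_eq_add_sub, sub_eq_iff_eq_add] at this
    rw [sub_add_eq_add_sub, this, add_sub_cancel_left]
  have h3 : (A + B * p.K₀) * (p.G₀ - 1) = p.G₀ * (A + B * p.K₀) := h2.trans h1.symm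
  generalize A + B * p.K₀ = M at h3 ⊢
  rw [Matrix.mul_sub, Matrix.mul_one] at h3
  simp only [Gd, neg_smul, one_smul, Matrix.add_mul, Matrix.mul_add, Matrix.one_mul, Matrix.mul_one,
    Matrix.neg_mul, Matrix.mul_neg]
  rw [← h3]
  abel

theorem dil_zero : p.dil 0 = 1 := by simp [dil]

theorem dil_add (s t : ℝ) : p.dil (s + t) = p.dil s * p.dil t := exp_smul_add _ _ _

theorem dil_dil (s t : ℝ) (v : Fin n → ℝ) : p.dil s *ᵥ (p.dil t *ᵥ v) = p.dil (s + t) *ᵥ v := by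
  rw [dil_add, Matrix.mulVec_mulVec]

theorem Admissible.dil_mul_B (hp : p.Admissible A B) (s : ℝ) : p.dil s * B = Real.exp s • B := by
  rw [dil, exp_mul_intertwine (H := s • 1), exp_smul_one]
  · simp
  · simp [hp.Gd_mul_B]

theorem Admissible.dil_mul_A₀ (hp : p.Admissible A B) (s : ℝ) :
    p.dil s * (A + B * p.K₀) = Real.exp s • ((A + B * p.K₀) * p.dil s) := by
  rw [dil, exp_mul_intertwine (H := s • (p.Gd + 1))]
  · rw [smul_add, Matrix.exp_add_of_commute, exp_smul_one]
    · simp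
    · exact ((Commute.one_right _).smul_right s)
  · rw [Matrix.smul_mul, hp.Gd_mul_A₀, Matrix.mul_smul]

theorem wnorm_eq (T : ℝ) (x : Fin n → ℝ) :
    p.wnorm T x = √(quadForm p.X⁻¹ (p.dil (-Real.log T) *ᵥ x)) := by
  rw [wnorm, quadForm]
  congr 1
  rw [← Matrix.mulVec_mulVec, ← Matrix.mulVec_mulVec, Matrix.dotProduct_mulVec,
    Matrix.vecMul_transpose]

end Design

/-! ### The canonical homogeneous norm -/

namespace Design
variable {n m : ℕ} {p : Design n m} {A : Matrix (Fin n) (Fin n) ℝ} {B : Matrix (Fin n) (Fin m) ℝ}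

theorem dil_mulVec_ne_zero (s : ℝ) {x : Fin n → ℝ} (hx : x ≠ 0) : p.dil s *ᵥ x ≠ 0 := by
  intro h
  apply hx
  have h1 := p.dil_dil (-s) s x
  rw [h] at h1
  simpa [dil_zero] using h1.symm

theorem dil_mulVec_smul (s r : ℝ) (x : Fin n → ℝ) : p.dil s *ᵥ (r • x) = r • (p.dil s *ᵥ x) :=
  Matrix.mulVec_smul _ _ _

theorem continuous_dil : Continuous p.dil := continuous_exp_smul _

/-- The dilation contracts the quadratic form of `X⁻¹` exponentially in backward time. -/
theorem Admissible.exists_dil_decay (hp : p.Admissible A B) :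
    ∃ c : ℝ, 0 < c ∧ ∀ (v : Fin n → ℝ) (r : ℝ), 0 ≤ r →
      quadForm p.X⁻¹ (p.dil (-r) *ᵥ v) ≤ Real.exp (-(c * r)) * quadForm p.X⁻¹ v := by
  obtain ⟨C, hC, h⟩ := exists_le_mul_of_homogeneous (continuous_quadForm p.dissip)
    (continuous_quadForm p.X⁻¹) (quadForm_smul _) (quadForm_smul _)
    (fun v hv => quadForm_pos hp.posDef_dissip hv)
  refine ⟨C⁻¹, inv_pos.2 hC, fun v r hr => ?_⟩
  -- `e^{r/C} q(d(-r) v)` is antitone, as its derivative is `e^{r/C} (q / C - dissip) ≤ 0`.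
  set f : ℝ → ℝ := fun r => Real.exp (C⁻¹ * r) * quadForm p.X⁻¹ (p.dil (-r) *ᵥ v) with hf
  have hd : ∀ r, HasDerivAt f (Real.exp (C⁻¹ * r) *
      (C⁻¹ * quadForm p.X⁻¹ (p.dil (-r) *ᵥ v) - quadForm p.dissip (p.dil (-r) *ᵥ v))) r := by
    intro r
    have h1 := hasDerivAt_quadForm_comp p.X⁻¹
      (hasDerivAt_exp_smul_mulVec p.Gd (hasDerivAt_neg r) (hasDerivAt_const r v))
    have h2 := ((hasDerivAt_id r).const_mul C⁻¹).exp.mul h1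
    refine h2.congr_deriv ?_
    rw [dissip, quadForm_mul_add]
    simp [dil, Matrix.mulVec_neg]
    ring
  have hanti : Antitone f := by
    refine antitone_of_deriv_nonpos (fun r => (hd r).differentiableAt) fun r => ?_
    rw [(hd r).deriv]
    refine mul_nonpos_of_nonneg_of_nonpos (Real.exp_pos _).le (sub_nonpos.2 ?_)
    rw [inv_mul_le_iff₀ hC]
    exact h _
  have h0 := hanti hr
  simp only [hf, mul_zero, Real.exp_zero, one_mul, neg_zero, dil_zero, Matrix.one_mulVec] at h0
  rw [Real.exp_neg, inv_mul_eq_div, le_div_iff₀ (Real.exp_pos _), mul_comm]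
  exact h0

/-- The squared norm `‖d(-s) x‖²`. The number `ln ‖x‖_d` is the solution `s` of `level T s x = 1`;
the factor `d(-ln T)` of the norm is absorbed in the dilation. -/
def level (p : Design n m) (T s : ℝ) (x : Fin n → ℝ) : ℝ :=
  quadForm p.X⁻¹ (p.dil (-(s + Real.log T)) *ᵥ x)

theorem wnorm_dil (T s : ℝ) (x : Fin n → ℝ) :
    p.wnorm T (p.dil (-s) *ᵥ x) = √(p.level T s x) := by
  rw [wnorm_eq, dil_dil, level, neg_add_rev]

theorem wnorm_eq_level (T : ℝ) (x : Fin n → ℝ) : p.wnorm T x = √(p.level T 0 x) := by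
  rw [wnorm_eq, level, zero_add]

theorem wnorm_smul (T : ℝ) {r : ℝ} (hr : 0 ≤ r) (x : Fin n → ℝ) :
    p.wnorm T (r • x) = r * p.wnorm T x := by
  rw [wnorm_eq, wnorm_eq, dil_mulVec_smul, quadForm_smul, Real.sqrt_mul (sq_nonneg r),
    Real.sqrt_sq hr]

theorem wnorm_zero (T : ℝ) : p.wnorm T 0 = 0 := by simp [wnorm_eq, quadForm_zero]

theorem Admissible.wnorm_pos (hp : p.Admissible A B) (T : ℝ) {x : Fin n → ℝ} (hx : x ≠ 0) :
    0 < p.wnorm T x := by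
  rw [wnorm_eq]
  exact Real.sqrt_pos.2 (quadForm_pos hp.posDef_inv (dil_mulVec_ne_zero _ hx))

theorem continuous_level_left (T : ℝ) (x : Fin n → ℝ) : Continuous fun s => p.level T s x :=
  (continuous_quadForm _).comp
    ((continuous_dil.comp (by fun_prop)).matrix_mulVec continuous_const)

theorem continuous_level_right (T s : ℝ) : Continuous (p.level T s) :=
  (continuous_quadForm _).comp (continuous_const.matrix_mulVec continuous_id)

theorem level_zero (T s : ℝ) : p.level T s 0 = 0 := by simp [level, quadForm_zero]

theorem Admissible.level_pos (hp : p.Admissible A B) (T s : ℝ) {x : Fin n → ℝ} (hx : x ≠ 0) :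
    0 < p.level T s x :=
  quadForm_pos hp.posDef_inv (dil_mulVec_ne_zero _ hx)

theorem Admissible.strictAnti_level (hp : p.Admissible A B) (T : ℝ) {x : Fin n → ℝ} (hx : x ≠ 0) :
    StrictAnti fun s => p.level T s x := by
  obtain ⟨c, hc, h⟩ := hp.exists_dil_decay
  intro s t hst
  have h1 := h (p.dil (-(s + Real.log T)) *ᵥ x) (t - s) (by linarith)
  rw [dil_dil, show -(t - s) + -(s + Real.log T) = -(t + Real.log T) by ring] at h1
  refine h1.trans_lt ?_
  have h2 : Real.exp (-(c * (t - s))) < 1 :=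
    Real.exp_lt_one_iff.2 (neg_neg_of_pos (mul_pos hc (by linarith)))
  exact mul_lt_of_lt_one_left (hp.level_pos T s hx) h2

theorem Admissible.exists_level_eq_one (hp : p.Admissible A B) (T : ℝ) {x : Fin n → ℝ}
    (hx : x ≠ 0) : ∃ s, p.level T s x = 1 := by
  obtain ⟨c, hc, h⟩ := hp.exists_dil_decay
  have hpos := hp.level_pos T 0 hx
  set a := p.level T 0 x with ha
  have hr : c * (|Real.log a| / c) = |Real.log a| := by field_simp
  have hr0 : 0 ≤ |Real.log a| / c := by positivity
  have hb := mem_range_of_exists_le_of_exists_ge (c := 1) (continuous_level_left (p := p) T x)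
    -- From `s = 0`, where the level is `a`, moving by `|ln a| / c` crosses the level `1`.
    ⟨|Real.log a| / c, ?_⟩ ⟨-(|Real.log a| / c), ?_⟩
  · exact hb
  · have h1 := h (p.dil (-(0 + Real.log T)) *ᵥ x) _ hr0
    rw [dil_dil, hr, ← neg_add, zero_add] at h1
    refine h1.trans ?_
    rw [← zero_add (Real.log T)]
    change _ * a ≤ 1
    rw [Real.exp_neg, inv_mul_le_iff₀ (Real.exp_pos _), mul_one]
    calc a = Real.exp (Real.log a) := (Real.exp_log hpos).symm
      _ ≤ _ := Real.exp_le_exp.2 (le_abs_self _)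
  · have h1 := h (p.dil (-(-(|Real.log a| / c) + Real.log T)) *ᵥ x) _ hr0
    rw [dil_dil, hr] at h1
    rw [show -(|Real.log a| / c) + -(-(|Real.log a| / c) + Real.log T) = -(0 + Real.log T) by ring]
      at h1
    change a ≤ _ * p.level T _ x at h1
    rw [Real.exp_neg, inv_mul_eq_div, le_div_iff₀ (Real.exp_pos _)] at h1
    refine le_trans ?_ h1
    calc (1 : ℝ) = a * Real.exp (-Real.log a) := by
          rw [Real.exp_neg, Real.exp_log hpos, mul_inv_cancel₀ hpos.ne']
      _ ≤ _ := by gcongr; exact neg_le_abs _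

theorem homNorm_zero (T : ℝ) : p.homNorm T 0 = 0 := by
  simp [homNorm, wnorm_zero]

theorem Admissible.homNorm_eq_exp (hp : p.Admissible A B) {T s : ℝ} {x : Fin n → ℝ}
    (h : p.level T s x = 1) : p.homNorm T x = Real.exp s := by
  have hx : x ≠ 0 := by
    rintro rfl
    simp [level_zero] at h
  have hex : ∃ s : ℝ, p.wnorm T (p.dil (-s) *ᵥ x) = 1 := ⟨s, by rw [wnorm_dil, h, Real.sqrt_one]⟩
  rw [homNorm, dif_pos hex]
  congr 1
  have h1 := hex.choose_spec
  rw [wnorm_dil, Real.sqrt_eq_one] at h1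
  exact (hp.strictAnti_level T hx).injective (h1.trans h.symm)

theorem Admissible.homNorm_pos (hp : p.Admissible A B) (T : ℝ) {x : Fin n → ℝ} (hx : x ≠ 0) :
    0 < p.homNorm T x := by
  obtain ⟨s, hs⟩ := hp.exists_level_eq_one T hx
  rw [hp.homNorm_eq_exp hs]
  exact Real.exp_pos s

theorem Admissible.level_log_homNorm (hp : p.Admissible A B) (T : ℝ) {x : Fin n → ℝ}
    (hx : x ≠ 0) : p.level T (Real.log (p.homNorm T x)) x = 1 := by
  obtain ⟨s, hs⟩ := hp.exists_level_eq_one T hx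
  rw [hp.homNorm_eq_exp hs, Real.log_exp, hs]

theorem Admissible.homNorm_lt_exp_iff (hp : p.Admissible A B) {T a : ℝ} {x : Fin n → ℝ} :
    p.homNorm T x < Real.exp a ↔ p.level T a x < 1 := by
  rcases eq_or_ne x 0 with rfl | hx
  · simp [homNorm_zero, level_zero, Real.exp_pos]
  · obtain ⟨s, hs⟩ := hp.exists_level_eq_one T hx
    rw [hp.homNorm_eq_exp hs, Real.exp_lt_exp, ← hs]
    exact (hp.strictAnti_level T hx).lt_iff_gt.symm

theorem Admissible.exp_lt_homNorm_iff (hp : p.Admissible A B) {T a : ℝ} {x : Fin n → ℝ} :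
    Real.exp a < p.homNorm T x ↔ 1 < p.level T a x := by
  rcases eq_or_ne x 0 with rfl | hx
  · rw [homNorm_zero, level_zero]
    exact iff_of_false (Real.exp_pos a).not_gt (by norm_num)
  · obtain ⟨s, hs⟩ := hp.exists_level_eq_one T hx
    rw [hp.homNorm_eq_exp hs, Real.exp_lt_exp, ← hs]
    exact (hp.strictAnti_level T hx).lt_iff_gt.symm

theorem Admissible.homNorm_nonneg (hp : p.Admissible A B) (T : ℝ) (x : Fin n → ℝ) :
    0 ≤ p.homNorm T x := by
  rcases eq_or_ne x 0 with rfl | hx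
  · exact (homNorm_zero T).ge
  · exact (hp.homNorm_pos T hx).le

theorem Admissible.continuous_homNorm (hp : p.Admissible A B) (T : ℝ) :
    Continuous (p.homNorm T) := by
  rw [continuous_iff_continuousAt]
  intro x
  refine tendsto_order.2 ⟨fun a ha => ?_, fun a ha => ?_⟩
  · rcases le_or_gt a 0 with h0 | h0
    · rcases h0.lt_or_eq with h1 | rfl
      · exact Filter.Eventually.of_forall fun y => h1.trans_le (hp.homNorm_nonneg T y)
      · have hx : x ≠ 0 := by
          rintro rfl
          simp [homNorm_zero] at ha
        filter_upwards [isOpen_ne.mem_nhds hx] with y hy using hp.homNorm_pos T hy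
    · rw [← Real.exp_log h0, hp.exp_lt_homNorm_iff] at ha
      filter_upwards [(continuous_level_right T _).continuousAt.eventually_const_lt ha] with y hy
      rw [← Real.exp_log h0]
      exact hp.exp_lt_homNorm_iff.2 hy
  · have h0 : 0 < a := (hp.homNorm_nonneg T x).trans_lt ha
    rw [gt_iff_lt, ← Real.exp_log h0, hp.homNorm_lt_exp_iff] at ha
    filter_upwards [(continuous_level_right T _).continuousAt.eventually_lt_const ha] with y hy
    rw [← Real.exp_log h0]
    exact hp.homNorm_lt_exp_iff.2 hy

theorem Admissible.homNorm_le_one_iff (hp : p.Admissible A B) {T : ℝ} {x : Fin n → ℝ} :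
    p.homNorm T x ≤ 1 ↔ p.wnorm T x ≤ 1 := by
  rw [← Real.exp_zero, ← not_lt, hp.exp_lt_homNorm_iff, wnorm_eq_level, Real.exp_zero,
    Real.sqrt_le_iff, not_lt]
  norm_num

end Design

/-! ### The homogeneous norm along the closed loop -/

open Asymptotics Filter in
/-- Implicit differentiation: a continuous solution `g` of `Φ (g r, r) = c` is differentiable where
the partial derivative of `Φ` in the first variable does not vanish. Differentiability of `Φ` at
the single point suffices, because `g` is given and assumed continuous. -/
theorem hasDerivAt_of_hasFDerivAt_eventually_const {Φ : ℝ × ℝ → ℝ} {D : ℝ × ℝ →L[ℝ] ℝ} {g : ℝ → ℝ}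
    {t c : ℝ} (hΦ : HasFDerivAt Φ D (g t, t)) (hg : ContinuousAt g t)
    (hc : ∀ᶠ r in nhds t, Φ (g r, r) = c) (h0 : D (1, 0) ≠ 0) :
    HasDerivAt g (-D (0, 1) / D (1, 0)) t := by
  have hlim : Tendsto (fun r => (g r, r)) (nhds t) (nhds (g t, t)) := hg.prodMk_nhds tendsto_id
  have h1 := (hasFDerivAt_iff_isLittleO.1 hΦ).comp_tendsto hlim
  have hct : Φ (g t, t) = c := hc.self_of_nhds
  have hD : ∀ a b : ℝ, D (a, b) = a * D (1, 0) + b * D (0, 1) := by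
    intro a b
    have : ((a, b) : ℝ × ℝ) = a • (1, 0) + b • (0, 1) := by simp
    rw [this, map_add, map_smul, map_smul, smul_eq_mul, smul_eq_mul]
  set w : ℝ → ℝ × ℝ := fun r => (g r, r) - (g t, t) with hw
  set ρ : ℝ → ℝ := fun r => g r - g t - (r - t) * (-D (0, 1) / D (1, 0)) with hρ
  have h2 : ρ =o[nhds t] w := by
    have h3 : (fun r => -(D (1, 0))⁻¹ * (Φ (g r, r) - Φ (g t, t) - D (w r))) =o[nhds t] w :=
      h1.const_mul_left _
    refine h3.congr' ?_ EventuallyEq.rfl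
    filter_upwards [hc] with r hr
    rw [hr, hct]
    simp only [hw, hρ, Prod.mk_sub_mk, hD (g r - g t)]
    field_simp
    ring
  have h3 : (fun r => ((ρ r, 0) : ℝ × ℝ)) =o[nhds t] w := by
    refine (IsBigO.of_bound 1 (Eventually.of_forall fun r => ?_)).trans_isLittleO h2
    simp [Prod.norm_def]
  have h4 : w =O[nhds t] fun r => r - t := by
    refine h3.right_isBigO_sub.trans ?_
    refine IsBigO.of_bound (|D (0, 1) / D (1, 0)| + 1) (Eventually.of_forall fun r => ?_)
    have : w r - (ρ r, 0) = (r - t) • (-D (0, 1) / D (1, 0), 1) := by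
      simp [hw, hρ]
    rw [this, norm_smul, mul_comm]
    gcongr
    rw [Prod.norm_def, neg_div]
    simp only [norm_neg, norm_one, Real.norm_eq_abs]
    exact max_le (by linarith [abs_nonneg (D (0, 1) / D (1, 0))])
      (by linarith [abs_nonneg (D (0, 1) / D (1, 0))])
  rw [hasDerivAt_iff_isLittleO]
  exact h2.trans_isBigO h4

namespace Design
variable {n m : ℕ} {p : Design n m} {A : Matrix (Fin n) (Fin n) ℝ} {B : Matrix (Fin n) (Fin m) ℝ}

/-- The closed-loop vector field for `z = y / ‖y₀‖`. The two dilations in the feedback are merged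
into one, with exponent `-(ln min {1, ‖z‖_d} + ln T)`. -/
def field (p : Design n m) (A : Matrix (Fin n) (Fin n) ℝ) (B : Matrix (Fin n) (Fin m) ℝ) (T : ℝ)
    (z : Fin n → ℝ) : Fin n → ℝ :=
  (A + B * p.K₀) *ᵥ z +
    B *ᵥ (p.K *ᵥ (p.dil (-(Real.log (min 1 (p.homNorm T z)) + Real.log T)) *ᵥ z))

theorem Admissible.field_eq (hp : p.Admissible A B) {T : ℝ} {y y₀ : Fin n → ℝ} (hy₀ : y₀ ≠ 0) :
    A *ᵥ y + B *ᵥ p.uct T y y₀ = p.wnorm T y₀ • p.field A B T ((p.wnorm T y₀)⁻¹ • y) := by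
  have hρ := (hp.wnorm_pos T hy₀).ne'
  rw [uct, if_neg hy₀, field]
  generalize p.homNorm T ((p.wnorm T y₀)⁻¹ • y) = N
  rw [neg_add_rev, dil_add]
  simp only [Matrix.mulVec_smul, smul_add, smul_smul, mul_inv_cancel₀ hρ, one_smul,
    Matrix.mulVec_add, Matrix.add_mulVec, Matrix.mulVec_mulVec, Matrix.mul_assoc, add_assoc]

theorem Admissible.continuousOn_field (hp : p.Admissible A B) (T : ℝ) :
    ContinuousOn (p.field A B T) {0}ᶜ := by
  have h1 : ContinuousOn (fun z => Real.log (min 1 (p.homNorm T z))) {0}ᶜ := by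
    refine ContinuousOn.log (continuous_const.min (hp.continuous_homNorm T)).continuousOn ?_
    intro z hz
    exact (lt_min one_pos (hp.homNorm_pos T hz)).ne'
  have h2 : ContinuousOn (fun z =>
      p.dil (-(Real.log (min 1 (p.homNorm T z)) + Real.log T)) *ᵥ z) {0}ᶜ := by
    have h3 := continuous_dil (p := p).comp_continuousOn (h1.add
      (continuousOn_const (c := Real.log T))).neg
    have h4 : Continuous fun q : Matrix (Fin n) (Fin n) ℝ × (Fin n → ℝ) => q.1 *ᵥ q.2 :=
      continuous_fst.matrix_mulVec continuous_snd
    exact h4.comp_continuousOn (h3.prodMk continuousOn_id)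
  have h5 : Continuous fun q : (Fin n → ℝ) × (Fin n → ℝ) =>
      (A + B * p.K₀) *ᵥ q.1 + B *ᵥ (p.K *ᵥ q.2) := by fun_prop
  exact h5.comp_continuousOn (continuousOn_id.prodMk h2)

/-- In the coordinate `d(s) z` the field `A₀ z + B K d(s) z` is `eˢ` times the linear closed
loop. -/
theorem Admissible.dil_mulVec_closedLoop (hp : p.Admissible A B) (s : ℝ) (z : Fin n → ℝ) :
    p.dil s *ᵥ ((A + B * p.K₀) *ᵥ z + B *ᵥ (p.K *ᵥ (p.dil s *ᵥ z))) =
      Real.exp s • (p.loop A B *ᵥ (p.dil s *ᵥ z)) := by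
  rw [Matrix.mulVec_add, Matrix.mulVec_mulVec, hp.dil_mul_A₀, Matrix.mulVec_mulVec _ _ B,
    hp.dil_mul_B, loop, Matrix.add_mulVec _ (B * p.K), smul_add]
  simp only [Matrix.smul_mulVec, Matrix.mulVec_mulVec, Matrix.mul_assoc, Matrix.smul_mul]

theorem Admissible.loop_dotProduct (hp : p.Admissible A B) (v : Fin n → ℝ) :
    (p.loop A B *ᵥ v) ⬝ᵥ (p.X⁻¹ *ᵥ v) + v ⬝ᵥ (p.X⁻¹ *ᵥ (p.loop A B *ᵥ v)) =
      - quadForm p.dissip v := by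
  rw [← quadForm_mul_add, hp.lyapunov_loop]
  simp [quadForm, Matrix.neg_mulVec]

/-- Along the normalised closed loop, inside the unit ball, `‖z‖_d` decreases with the constant
slope `-1/T`. -/
theorem Admissible.hasDerivAt_homNorm (hp : p.Admissible A B) {T : ℝ} (hT : 0 < T)
    {z : ℝ → Fin n → ℝ} {t : ℝ} (hz : HasDerivAt z (p.field A B T (z t)) t) (h0 : z t ≠ 0)
    (h1 : p.homNorm T (z t) ≤ 1) :
    HasDerivAt (fun t => p.homNorm T (z t)) (-T⁻¹) t := by
  have hN := hp.homNorm_pos T h0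
  set N : ℝ → ℝ := fun t => p.homNorm T (z t) with hNdef
  set g : ℝ → ℝ := fun t => Real.log (N t) with hgdef
  have hNc : ContinuousAt N t := (hp.continuous_homNorm T).continuousAt.comp hz.continuousAt
  have hgc : ContinuousAt g t := hNc.log hN.ne'
  have hne : ∀ᶠ r in nhds t, z r ≠ 0 := hz.continuousAt.eventually_ne h0
  have hev : ∀ᶠ r in nhds t, (fun q : ℝ × ℝ => p.level T q.1 (z q.2)) (g r, r) = 1 := by
    filter_upwards [hne] with r hr using hp.level_log_homNorm T hr
  have hs : HasFDerivAt (fun q : ℝ × ℝ => -(q.1 + Real.log T))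
      (-(ContinuousLinearMap.fst ℝ ℝ ℝ)) (g t, t) :=
    ((hasFDerivAt_fst).add_const _).neg
  have hv : HasFDerivAt (fun q : ℝ × ℝ => z q.2)
      ((ContinuousLinearMap.toSpanSingleton ℝ (p.field A B T (z t))).comp
        (ContinuousLinearMap.snd ℝ ℝ ℝ)) (g t, t) :=
    HasFDerivAt.comp (g := z) (f := Prod.snd) (g t, t) hz.hasFDerivAt hasFDerivAt_snd
  -- `D` is the derivative at `(g t, t)` of `(s, r) ↦ ‖d(-s) z(r)‖²`, which equals `1` on the curve
  -- `(g r, r)`.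
  obtain ⟨D, hD, hDapp⟩ := hasFDerivAt_quadForm_comp p.X⁻¹ (hasFDerivAt_exp_smul_mulVec p.Gd hs hv)
  set v := p.dil (-(g t + Real.log T)) *ᵥ z t with hvdef
  have hvne : v ≠ 0 := dil_mulVec_ne_zero _ h0
  have hpos := quadForm_pos hp.posDef_dissip hvne
  have hfield : p.dil (-(g t + Real.log T)) *ᵥ p.field A B T (z t) =
      Real.exp (-(g t + Real.log T)) • (p.loop A B *ᵥ v) := by
    rw [field, min_eq_right h1]
    exact hp.dil_mulVec_closedLoop _ _
  have hD1 : D (1, 0) = - quadForm p.dissip v := by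
    rw [hDapp, dissip, quadForm_mul_add]
    simp [hvdef, dil, Matrix.mulVec_neg]
    ring
  have hD2 : D (0, 1) = Real.exp (-(g t + Real.log T)) * -quadForm p.dissip v := by
    rw [hDapp, ← hp.loop_dotProduct]
    change (((-(ContinuousLinearMap.fst ℝ ℝ ℝ)) (0, 1)) • _ +
      p.dil (-(g t + Real.log T)) *ᵥ ((1 : ℝ) • p.field A B T (z t))) ⬝ᵥ (p.X⁻¹ *ᵥ v) +
      v ⬝ᵥ (p.X⁻¹ *ᵥ (((-(ContinuousLinearMap.fst ℝ ℝ ℝ)) (0, 1)) • _ +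
      p.dil (-(g t + Real.log T)) *ᵥ ((1 : ℝ) • p.field A B T (z t)))) = _
    rw [one_smul, hfield]
    simp [Matrix.mulVec_smul, mul_add]
  have hg := hasDerivAt_of_hasFDerivAt_eventually_const hD hgc hev (by rw [hD1]; linarith)
  have h2 := hg.exp
  have h3 : (fun r => Real.exp (g r)) =ᶠ[nhds t] N := by
    filter_upwards [hne] with r hr using Real.exp_log (hp.homNorm_pos T hr)
  refine (h2.congr_of_eventuallyEq h3.symm).congr_deriv ?_
  rw [hD1, hD2, neg_add, Real.exp_add, Real.exp_neg, Real.exp_neg, hgdef, Real.exp_log hN,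
    Real.exp_log hT]
  field_simp

/-- Outside the unit ball the feedback is linear and the squared norm does not increase. -/
theorem Admissible.hasDerivAt_level (hp : p.Admissible A B) {T : ℝ}
    {z : ℝ → Fin n → ℝ} {t : ℝ} (hz : HasDerivAt z (p.field A B T (z t)) t)
    (h1 : 1 ≤ p.homNorm T (z t)) :
    ∃ d ≤ 0, HasDerivAt (fun t => p.level T 0 (z t)) d t := by
  have h2 := hasDerivAt_quadForm_comp p.X⁻¹
    (hasDerivAt_exp_smul_mulVec p.Gd (hasDerivAt_const t (-(0 + Real.log T))) hz)
  refine ⟨_, ?_, h2⟩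
  have h3 := hp.dil_mulVec_closedLoop (-(0 + Real.log T)) (z t)
  have h4 : p.field A B T (z t) = (A + B * p.K₀) *ᵥ z t +
      B *ᵥ (p.K *ᵥ (p.dil (-(0 + Real.log T)) *ᵥ z t)) := by
    rw [field, min_eq_left h1, Real.log_one]
  rw [← h4] at h3
  set v := p.dil (-(0 + Real.log T)) *ᵥ z t
  change ((0 : ℝ) • _ + p.dil (-(0 + Real.log T)) *ᵥ p.field A B T (z t)) ⬝ᵥ (p.X⁻¹ *ᵥ v) +
    v ⬝ᵥ (p.X⁻¹ *ᵥ ((0 : ℝ) • _ + p.dil (-(0 + Real.log T)) *ᵥ p.field A B T (z t))) ≤ 0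
  rw [h3, zero_smul, zero_add, Matrix.mulVec_smul, smul_dotProduct, dotProduct_smul, ← smul_add,
    hp.loop_dotProduct, smul_neg, neg_nonpos]
  exact mul_nonneg (Real.exp_pos _).le (quadForm_nonneg hp.posDef_dissip _)

end Design

/-! ### Trajectories of the normalised closed loop -/

/-- If `ż = F(z)` almost everywhere on `{z ∈ S}`, in integrated form, with `F` continuous on the
open set `S`, then the equation holds at every time at which `z ∈ S`. -/
theorem hasDerivAt_of_sub_eq_integral {E : Type*} [NormedAddCommGroup E] [NormedSpace ℝ E]
    [CompleteSpace E] {z w : ℝ → E} {F : E → E} {S : Set E} (hS : IsOpen S)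
    (hF : ContinuousOn F S) (hz : ContinuousOn z (Ici 0))
    (hw : ∀ a b, 0 ≤ a → a ≤ b → z b - z a = ∫ s in a..b, w s)
    (hwF : ∀ᵐ s ∂(volume.restrict (Ioi (0 : ℝ))), z s ∈ S → w s = F (z s))
    {t : ℝ} (ht : 0 < t) (htS : z t ∈ S) : HasDerivAt z (F (z t)) t := by
  have hzt : ContinuousAt z t := hz.continuousAt (Ici_mem_nhds ht)
  obtain ⟨ε, hε, hball⟩ := Metric.mem_nhds_iff.1
    (Filter.inter_mem (Ioi_mem_nhds ht) (hzt.preimage_mem_nhds (hS.mem_nhds htS)))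
  have hcont : ContinuousOn (fun s => F (z s)) (Metric.ball t ε) :=
    hF.comp (hz.mono fun s hs => mem_Ici.2 (le_of_lt (hball hs).1)) fun s hs => (hball hs).2
  have h1 : HasDerivAt (fun r => z t + ∫ s in t..r, F (z s)) (F (z t)) t := by
    refine (intervalIntegral.integral_hasDerivAt_right (by simp) ?_ ?_).const_add _
    · exact hcont.stronglyMeasurableAtFilter Metric.isOpen_ball t (Metric.mem_ball_self hε)
    · exact hcont.continuousAt (Metric.ball_mem_nhds t hε)
  refine h1.congr_of_eventuallyEq ?_
  filter_upwards [Metric.ball_mem_nhds t hε] with r hr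
  have hsub : uIcc t r ⊆ Metric.ball t ε := by
    rw [Real.ball_eq_Ioo] at hr ⊢
    exact OrdConnected.uIcc_subset ordConnected_Ioo (by simpa using hε) hr
  have h2 : ∫ s in t..r, F (z s) = ∫ s in t..r, w s := by
    refine intervalIntegral.integral_congr_ae ?_
    filter_upwards [(ae_restrict_iff' measurableSet_Ioi).1 hwF] with s hs hmem
    have := hball (hsub (uIoc_subset_uIcc hmem))
    exact (hs this.1 this.2).symm
  have hr0 : 0 < r := (hball hr).1
  rw [h2]
  rcases le_total t r with h | h
  · rw [← hw t r ht.le h]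
    abel
  · rw [intervalIntegral.integral_symm, ← hw r t hr0.le h]
    abel

/-- A nonnegative continuous function that has slope `-c` wherever it is positive reaches `0` along
a straight line and stays there. -/
theorem eq_max_sub_mul_of_hasDerivAt {E : ℝ → ℝ} {c T : ℝ} (hc : 0 < c)
    (hE : ContinuousOn E (Ici 0)) (hnonneg : ∀ t, 0 ≤ E t) (h0 : E 0 = c * T)
    (hd : ∀ t, 0 < t → 0 < E t → HasDerivAt E (-c) t) {t : ℝ} (ht : 0 ≤ t) :
    E t = max (c * (T - t)) 0 := by
  have hlin : ∀ a b, 0 ≤ a → a ≤ b → (∀ s ∈ Ioo a b, 0 < E s) → E b + c * b = E a + c * a := by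
    intro a b ha hab hpos
    rcases hab.eq_or_lt with rfl | hab
    · rfl
    obtain ⟨s, hs, hs'⟩ := exists_hasDerivAt_eq_slope E (fun _ => -c) hab
      (hE.mono fun s hs => ha.trans hs.1) fun s hs => hd s (ha.trans_lt hs.1) (hpos s hs)
    rw [eq_div_iff (by linarith)] at hs'
    linarith
  have hzero : IsClosed {s | s ∈ Icc 0 t ∧ E s = 0} :=
    (hE.mono fun s hs => hs.1).preimage_isClosed_of_isClosed isClosed_Icc isClosed_singleton
  have hcpt : IsCompact {s | s ∈ Icc 0 t ∧ E s = 0} :=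
    isCompact_Icc.of_isClosed_subset hzero fun s hs => hs.1
  rcases Set.eq_empty_or_nonempty {s | s ∈ Icc 0 t ∧ E s = 0} with hemp | hne
  · have hpos : ∀ s ∈ Icc 0 t, 0 < E s := fun s hs =>
      (hnonneg s).lt_of_ne fun h => (hemp.subset ⟨hs, h.symm⟩ : s ∈ (∅ : Set ℝ))
    have h1 := hlin 0 t le_rfl ht fun s hs => hpos s ⟨hs.1.le, hs.2.le⟩
    have h2 := hpos t ⟨ht, le_rfl⟩
    rw [max_eq_left] <;> linarith
  · -- Before the first zero `a` the graph is a line, so `a = T`; after the last zero `b` it would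
    -- be a line of slope `-c` starting at `0`, so `E t = 0`.
    obtain ⟨a, ⟨ha, ha0⟩, hla⟩ := hcpt.exists_isLeast hne
    obtain ⟨b, ⟨hb, hb0⟩, hgb⟩ := hcpt.exists_isGreatest hne
    have h1 := hlin 0 a le_rfl ha.1 fun s hs => (hnonneg s).lt_of_ne fun h =>
      hs.2.not_ge (hla ⟨⟨hs.1.le, hs.2.le.trans ha.2⟩, h.symm⟩)
    have haT : a = T := by
      have : c * a = c * T := by linarith
      exact mul_left_cancel₀ hc.ne' this
    have h2 := hlin b t hb.1 hb.2 fun s hs => (hnonneg s).lt_of_ne fun h =>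
      hs.1.not_ge (hgb ⟨⟨hb.1.trans hs.1.le, hs.2.le⟩, h.symm⟩)
    have h3 : E t = 0 := by
      have := mul_le_mul_of_nonneg_left hb.2 hc.le
      linarith [hnonneg t]
    have h4 : c * (T - t) ≤ 0 := mul_nonpos_of_nonneg_of_nonpos hc.le (by linarith [ha.2])
    rw [h3, max_eq_right h4]

/-- A function whose derivative is nonpositive wherever it exceeds `c` cannot cross the value `c`
upwards. -/
theorem le_of_hasDerivAt_nonpos_above {V : ℝ → ℝ} {c : ℝ} (hV : ContinuousOn V (Ici 0))
    (h0 : V 0 ≤ c) (hd : ∀ t, 0 < t → c < V t → ∃ d ≤ 0, HasDerivAt V d t) {t : ℝ} (ht : 0 ≤ t) :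
    V t ≤ c := by
  by_contra! hlt
  have hclosed : IsClosed {s | s ∈ Icc 0 t ∧ V s ≤ c} :=
    (hV.mono fun s hs => hs.1).preimage_isClosed_of_isClosed isClosed_Icc isClosed_Iic
  have hcpt : IsCompact {s | s ∈ Icc 0 t ∧ V s ≤ c} :=
    isCompact_Icc.of_isClosed_subset hclosed fun s hs => hs.1
  obtain ⟨b, ⟨hb, hb0⟩, hgb⟩ := hcpt.exists_isGreatest ⟨0, ⟨le_rfl, ht⟩, h0⟩
  have hbt : b < t := hb.2.lt_of_ne (by rintro rfl; exact hb0.not_gt hlt)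
  have hd' : ∀ s ∈ Ioo b t, ∃ d ≤ 0, HasDerivAt V d s := fun s hs =>
    hd s (hb.1.trans_lt hs.1) (not_le.1 fun h =>
      hs.1.not_ge (hgb ⟨⟨hb.1.trans hs.1.le, hs.2.le⟩, h⟩))
  have hanti : AntitoneOn V (Icc b t) := by
    refine antitoneOn_of_deriv_nonpos (convex_Icc b t) (hV.mono fun s hs => hb.1.trans hs.1) ?_ ?_
    · rw [interior_Icc]
      intro s hs
      obtain ⟨d, -, h⟩ := hd' s hs
      exact h.differentiableAt.differentiableWithinAt
    · rw [interior_Icc]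
      intro s hs
      obtain ⟨d, h1, h⟩ := hd' s hs
      rwa [h.deriv]
  have := hanti ⟨le_rfl, hbt.le⟩ ⟨hbt.le, le_rfl⟩ hbt.le
  linarith

namespace Design
variable {n m : ℕ} {p : Design n m} {A : Matrix (Fin n) (Fin n) ℝ} {B : Matrix (Fin n) (Fin m) ℝ}

/-- A trajectory of the normalised closed loop that starts on the unit sphere stays in the unit
ball, and its homogeneous norm is `max (1 - t/T) 0`. -/
theorem Admissible.homNorm_trajectory (hp : p.Admissible A B) {T : ℝ} (hT : 0 < T)
    {z : ℝ → Fin n → ℝ} (hz : ContinuousOn z (Ici 0)) (h0 : p.wnorm T (z 0) = 1)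
    (hd : ∀ t, 0 < t → z t ≠ 0 → HasDerivAt z (p.field A B T (z t)) t) {t : ℝ} (ht : 0 ≤ t) :
    p.wnorm T (z t) ≤ 1 ∧ p.homNorm T (z t) = max (T⁻¹ * (T - t)) 0 := by
  have hle : ∀ t, 0 ≤ t → p.homNorm T (z t) ≤ 1 := by
    intro t ht
    rw [← Real.exp_zero, ← not_lt, hp.exp_lt_homNorm_iff, not_lt]
    refine le_of_hasDerivAt_nonpos_above (V := fun t => p.level T 0 (z t))
      ((continuous_level_right T 0).comp_continuousOn hz) ?_ ?_ ht
    · rw [wnorm_eq_level, Real.sqrt_eq_one] at h0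
      exact h0.le
    · intro s hs h1
      refine hp.hasDerivAt_level (hd s hs ?_) ?_
      · intro h
        rw [h, level_zero] at h1
        linarith
      · rw [← hp.exp_lt_homNorm_iff, Real.exp_zero] at h1
        exact h1.le
  refine ⟨hp.homNorm_le_one_iff.1 (hle t ht), ?_⟩
  refine eq_max_sub_mul_of_hasDerivAt (E := fun t => p.homNorm T (z t)) (inv_pos.2 hT)
    ((hp.continuous_homNorm T).comp_continuousOn hz) (fun s => hp.homNorm_nonneg T _) ?_ ?_ ht
  · rw [inv_mul_cancel₀ hT.ne', ← Real.exp_zero]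
    refine hp.homNorm_eq_exp ?_
    rwa [wnorm_eq_level, Real.sqrt_eq_one] at h0
  · intro s hs hpos
    have hne : z s ≠ 0 := by
      intro h
      simp [h, homNorm_zero] at hpos
    exact hp.hasDerivAt_homNorm hT (hd s hs hne) hne (hle s hs.le)

end Design

/-! ### Arbitrary solutions of the delayed system -/

variable {n m : ℕ}

theorem ae_Ioi_comp_add {P : ℝ → Prop} (h : ∀ᵐ t ∂(volume.restrict (Ioi (0 : ℝ))), P t) {τ : ℝ}
    (hτ : 0 ≤ τ) : ∀ᵐ t ∂(volume.restrict (Ioi (0 : ℝ))), P (t + τ) := by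
  rw [ae_restrict_iff' measurableSet_Ioi] at h ⊢
  filter_upwards [(measurePreserving_add_right volume τ).quasiMeasurePreserving.ae h] with t ht h0
  exact ht (add_pos_of_pos_of_nonneg h0 hτ)

theorem exp_smul_mulVec_ne_zero {A : Matrix (Fin n) (Fin n) ℝ} (t : ℝ) {v : Fin n → ℝ}
    (hv : v ≠ 0) : NormedSpace.exp (t • A) *ᵥ v ≠ 0 := by
  intro h
  apply hv
  have h1 := exp_smul_add A (-t) t
  have h2 : NormedSpace.exp ((-t) • A) *ᵥ (NormedSpace.exp (t • A) *ᵥ v) = v := by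
    rw [Matrix.mulVec_mulVec, ← h1]
    simp
  rw [← h2, h, Matrix.mulVec_zero]

/-- The predictor predicts: Artstein's transform of `x` at time `t` is `x (t + τ)`. -/
theorem predictor_eq {A : Matrix (Fin n) (Fin n) ℝ} {B : Matrix (Fin n) (Fin m) ℝ}
    {x : ℝ → Fin n → ℝ} {u : ℝ → Fin m → ℝ} {τ t : ℝ} (hτ : 0 ≤ τ) (ht : 0 ≤ t) (hx : W1InfLoc x)
    (hd : ∀ᵐ t ∂(volume.restrict (Ioi (0 : ℝ))), HasDerivAt x (A *ᵥ x t + B *ᵥ u (t - τ)) t) :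
    x (t + τ) = NormedSpace.exp (τ • A) *ᵥ x t +
      ∫ θ in (-τ)..0, NormedSpace.exp ((-θ) • A) *ᵥ (B *ᵥ u (t + θ)) := by
  have hAC : AbsolutelyContinuousOnInterval x t (t + τ) := by
    refine (hx (t + τ + 1) (by linarith)).1.mono ?_
    rw [uIcc_of_le (by linarith), uIcc_of_le (by linarith)]
    exact Icc_subset_Icc ht (by linarith)
  rw [ae_restrict_iff' measurableSet_Ioi] at hd
  rw [variation_of_constants A (w := fun s => B *ᵥ u (s - τ)) (by linarith) hAC
    (hd.mono fun s hs hmem => hs (ht.trans_lt hmem.1))]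
  rw [add_sub_cancel_left]
  congr 1
  have h := intervalIntegral.integral_comp_add_right (a := -τ) (b := 0)
    (fun s => NormedSpace.exp ((t + τ - s) • A) *ᵥ (B *ᵥ u (s - τ))) (t + τ)
  rw [show -τ + (t + τ) = t by ring, zero_add] at h
  rw [← h]
  congr 1
  funext θ
  rw [show t + τ - (θ + (t + τ)) = -θ by ring, show θ + (t + τ) - τ = t + θ by ring]

namespace IsSolution
variable {p : Design n m} {A : Matrix (Fin n) (Fin n) ℝ} {B : Matrix (Fin n) (Fin m) ℝ}
  {T τ : ℝ} {x₀ : Fin n → ℝ} {x y : ℝ → Fin n → ℝ} {u : ℝ → Fin m → ℝ}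

theorem y_eq_shift {φ : ℝ → Fin m → ℝ} (h : IsSolution A B p T τ φ x₀ x y u) (hτ : 0 ≤ τ) {t : ℝ}
    (ht : 0 ≤ t) : y t = x (t + τ) := by
  rw [h.predictor t ht, predictor_eq hτ ht h.x_reg h.plant]

/-- Up to the time `τ` only the zero initial control acts on the plant. -/
theorem x_eq_exp (h : IsSolution A B p T τ 0 x₀ x y u) {t : ℝ} (ht : 0 ≤ t) (htτ : t ≤ τ) :
    x t = NormedSpace.exp (t • A) *ᵥ x₀ := by
  have hAC : AbsolutelyContinuousOnInterval x 0 t := by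
    refine (h.x_reg (t + 1) (by linarith)).1.mono ?_
    rw [uIcc_of_le (by linarith), uIcc_of_le (by linarith)]
    exact Icc_subset_Icc le_rfl (by linarith)
  have hd := (ae_restrict_iff' measurableSet_Ioi).1 h.plant
  have hu := (ae_restrict_iff' measurableSet_Ioo).1 h.u_init
  have hu' := (measurePreserving_sub_right volume τ).quasiMeasurePreserving.ae hu
  have hne : ∀ᵐ s : ℝ, s ≠ τ := by simp [ae_iff]
  rw [variation_of_constants A (w := fun _ => 0) ht hAC]
  · simp [h.x_init]
  · filter_upwards [hd, hu', hne] with s hs hus hsτ hmem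
    have h1 := hus ⟨by linarith [hmem.1], by
      have := lt_of_le_of_ne (hmem.2.trans htτ) hsτ
      linarith⟩
    have h2 := hs hmem.1
    rw [h1] at h2
    simpa using h2

theorem hasDerivAt_y {φ : ℝ → Fin m → ℝ} (h : IsSolution A B p T τ φ x₀ x y u) (hτ : 0 ≤ τ) :
    ∀ᵐ t ∂(volume.restrict (Ioi (0 : ℝ))), HasDerivAt y (A *ᵥ y t + B *ᵥ u t) t := by
  filter_upwards [ae_Ioi_comp_add h.plant hτ, ae_restrict_mem measurableSet_Ioi] with t ht h0
  rw [add_sub_cancel_right, ← h.y_eq_shift hτ (le_of_lt h0)] at ht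
  refine (ht.comp_add_const t τ).congr_of_eventuallyEq ?_
  filter_upwards [Ioi_mem_nhds h0] with s hs using h.y_eq_shift hτ (le_of_lt hs)

theorem absolutelyContinuousOnInterval_y {φ : ℝ → Fin m → ℝ}
    (h : IsSolution A B p T τ φ x₀ x y u) {a b : ℝ} (ha : 0 ≤ a) (hab : a ≤ b) :
    AbsolutelyContinuousOnInterval y a b := by
  refine (h.y_reg (b + 1) (by linarith)).1.mono ?_
  rw [uIcc_of_le (by linarith), uIcc_of_le (by linarith)]
  exact Icc_subset_Icc ha (by linarith)

theorem continuousOn_y {φ : ℝ → Fin m → ℝ} (h : IsSolution A B p T τ φ x₀ x y u) :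
    ContinuousOn y (Ici 0) := by
  intro t ht
  have h1 := (h.absolutelyContinuousOnInterval_y le_rfl
    (by linarith [mem_Ici.1 ht] : (0 : ℝ) ≤ t + 1)).continuousOn
  rw [uIcc_of_le (by linarith [mem_Ici.1 ht])] at h1
  refine (h1 t ⟨ht, by linarith⟩).mono_of_mem_nhdsWithin ?_
  exact Filter.mem_of_superset (inter_mem_nhdsWithin _ (Iio_mem_nhds (by linarith : t < t + 1)))
    fun s hs => ⟨hs.1, le_of_lt hs.2⟩

theorem y_sub_eq_integral {φ : ℝ → Fin m → ℝ} (h : IsSolution A B p T τ φ x₀ x y u) (hτ : 0 ≤ τ)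
    {a b : ℝ} (ha : 0 ≤ a) (hab : a ≤ b) :
    y b - y a = ∫ s in a..b, (A *ᵥ y s + B *ᵥ u s) := by
  have h1 := variation_of_constants 0 (w := fun s => A *ᵥ y s + B *ᵥ u s) hab
    (h.absolutelyContinuousOnInterval_y ha hab) ?_
  · rw [h1]
    simp
  · filter_upwards [(ae_restrict_iff' measurableSet_Ioi).1 (h.hasDerivAt_y hτ)] with s hs hmem
    simpa using hs (ha.trans_lt hmem.1)

/-- For `y(0) = 0` the value `0` of the norm collapses the set-valued feedback at `y = 0`, so the
closed loop is linear. -/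
theorem y_eq_zero {φ : ℝ → Fin m → ℝ} (h : IsSolution A B p T τ φ x₀ x y u) (hτ : 0 ≤ τ)
    (h0 : y 0 = 0) {t : ℝ} (ht : 0 ≤ t) : y t = 0 := by
  rw [variation_of_constants (A + B * (p.K₀ + p.K * p.dil (-Real.log T))) (w := fun _ => 0) ht
    (h.absolutelyContinuousOnInterval_y le_rfl ht)]
  · simp [h0]
  · filter_upwards [(ae_restrict_iff' measurableSet_Ioi).1 (h.hasDerivAt_y hτ),
      (ae_restrict_iff' measurableSet_Ioi).1 h.feedback] with s hs hfb hmem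
    have h1 := hs hmem.1
    have h2 : u s = (p.K₀ + p.K * p.dil (-Real.log T)) *ᵥ y s := by
      rcases hfb hmem.1 with ⟨-, hu⟩ | ⟨hy, b, -, hu⟩
      · rw [hu, h0, Design.uct, if_pos rfl]
      · rw [hu, h0, hy, Design.wnorm_zero, zero_smul, Matrix.mulVec_zero]
    rw [h2] at h1
    rwa [add_zero, Matrix.add_mulVec, ← Matrix.mulVec_mulVec]

theorem y_trajectory {φ : ℝ → Fin m → ℝ} (h : IsSolution A B p T τ φ x₀ x y u)
    (hp : p.Admissible A B) (hT : 0 < T) (hτ : 0 ≤ τ)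
    (h0 : y 0 ≠ 0) {t : ℝ} (ht : 0 ≤ t) :
    p.wnorm T (y t) ≤ p.wnorm T (y 0) ∧ (y t = 0 ↔ T ≤ t) := by
  have hρ := hp.wnorm_pos T h0
  set ρ := p.wnorm T (y 0) with hρdef
  have hcont : ContinuousOn (fun t => ρ⁻¹ • y t) (Ici 0) :=
    (continuous_const_smul ρ⁻¹).comp_continuousOn h.continuousOn_y
  have hd : ∀ t, 0 < t → ρ⁻¹ • y t ≠ 0 →
      HasDerivAt (fun t => ρ⁻¹ • y t) (p.field A B T (ρ⁻¹ • y t)) t := by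
    intro t ht hne
    refine hasDerivAt_of_sub_eq_integral (z := fun t => ρ⁻¹ • y t)
      (w := fun s => ρ⁻¹ • (A *ᵥ y s + B *ᵥ u s)) isOpen_compl_singleton
      (hp.continuousOn_field T) hcont ?_ ?_ ht hne
    · intro a b ha hab
      rw [intervalIntegral.integral_smul, ← h.y_sub_eq_integral hτ ha hab, smul_sub]
    · filter_upwards [h.feedback] with s hs hmem
      rcases hs with ⟨-, hu⟩ | ⟨hy, -⟩
      · rw [hu, hp.field_eq h0, smul_smul, inv_mul_cancel₀ hρ.ne', one_smul]
      · simp [hy] at hmem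
  have h1 : p.wnorm T (ρ⁻¹ • y 0) = 1 := by
    rw [Design.wnorm_smul T (inv_nonneg.2 hρ.le), inv_mul_cancel₀ hρ.ne']
  obtain ⟨h2, h3⟩ := hp.homNorm_trajectory hT hcont h1 hd ht
  rw [Design.wnorm_smul T (inv_nonneg.2 hρ.le), inv_mul_le_iff₀ hρ, mul_one] at h2
  refine ⟨h2, ?_⟩
  constructor
  · intro hy
    rw [hy, smul_zero, Design.homNorm_zero] at h3
    have h4 : T⁻¹ * (T - t) ≤ 0 := h3 ▸ le_max_left _ _
    have := nonpos_of_mul_nonpos_right h4 (inv_pos.2 hT)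
    linarith
  · intro hTt
    rw [max_eq_right (mul_nonpos_of_nonneg_of_nonpos (inv_nonneg.2 hT.le) (by linarith))] at h3
    by_contra hy
    exact (hp.homNorm_pos T (smul_ne_zero (inv_ne_zero hρ.ne') hy)).ne' h3

theorem y_zero (h : IsSolution A B p T τ 0 x₀ x y u) (hτ : 0 ≤ τ) :
    y 0 = NormedSpace.exp (τ • A) *ᵥ x₀ := by
  rw [h.y_eq_shift hτ le_rfl, zero_add, h.x_eq_exp hτ le_rfl]

end IsSolution

theorem Design.Admissible.exists_wnorm_exp_le {p : Design n m} {A : Matrix (Fin n) (Fin n) ℝ}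
    {B : Matrix (Fin n) (Fin m) ℝ} (hp : p.Admissible A B) (T τ : ℝ) :
    ∃ C : ℝ, 0 < C ∧ ∀ t ∈ Icc 0 τ, ∀ v : Fin n → ℝ,
      p.wnorm T (NormedSpace.exp (t • A) *ᵥ v) ≤ C * p.wnorm T v := by
  have hsq : ∀ (r : ℝ) (v : Fin n → ℝ), ‖r • v‖ ^ 2 = r ^ 2 * ‖v‖ ^ 2 := by
    intro r v
    rw [norm_smul, mul_pow, Real.norm_eq_abs, sq_abs]
  have hlev : ∀ (r : ℝ) (v : Fin n → ℝ), p.level T 0 (r • v) = r ^ 2 * p.level T 0 v := by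
    intro r v
    rw [Design.level, Design.dil_mulVec_smul, quadForm_smul, Design.level]
  obtain ⟨C₁, h₁, hC₁⟩ := exists_le_mul_of_homogeneous
    (f := fun v : Fin n → ℝ => ‖v‖ ^ 2) (g := p.level T 0) (by fun_prop)
    (Design.continuous_level_right T 0) hsq hlev fun v hv => by positivity
  obtain ⟨C₂, h₂, hC₂⟩ := exists_le_mul_of_homogeneous
    (f := p.level T 0) (g := fun v : Fin n → ℝ => ‖v‖ ^ 2)
    (Design.continuous_level_right T 0) (by fun_prop) hlev hsq fun v hv => hp.level_pos T 0 hv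
  obtain ⟨C₃, hC₃⟩ := isCompact_Icc.exists_bound_of_continuousOn (s := Icc 0 τ)
    (f := fun t : ℝ => NormedSpace.exp (t • toCLM A))
    (differentiable_exp_smul_const ℝ (toCLM A)).continuous.continuousOn
  refine ⟨√(C₁ * C₃ ^ 2 * C₂) + 1, by positivity, fun t ht v => ?_⟩
  have h3 : ‖NormedSpace.exp (t • A) *ᵥ v‖ ^ 2 ≤ C₃ ^ 2 * ‖v‖ ^ 2 := by
    rw [exp_mulVec, map_smul, ← mul_pow]
    gcongr
    exact (ContinuousLinearMap.le_opNorm _ _).trans (by gcongr; exact hC₃ t ht)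
  have h4 : p.level T 0 (NormedSpace.exp (t • A) *ᵥ v) ≤ C₁ * C₃ ^ 2 * C₂ * p.level T 0 v :=
    calc _ ≤ C₁ * ‖NormedSpace.exp (t • A) *ᵥ v‖ ^ 2 := hC₁ _
      _ ≤ C₁ * (C₃ ^ 2 * (C₂ * p.level T 0 v)) := by
        gcongr
        exact h3.trans (by gcongr; exact hC₂ v)
      _ = _ := by ring
  rw [Design.wnorm_eq_level, Design.wnorm_eq_level]
  calc _ ≤ √(C₁ * C₃ ^ 2 * C₂ * p.level T 0 v) := Real.sqrt_le_sqrt h4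
    _ = √(C₁ * C₃ ^ 2 * C₂) * √(p.level T 0 v) := Real.sqrt_mul (by positivity) _
    _ ≤ _ := by gcongr; linarith

/-! ### Existence: the explicit orbit -/

/-- A continuous function that is differentiable off a countable set, with locally bounded
derivative, is locally Lipschitz, hence in `W^{1,∞}_loc`. -/
theorem w1InfLoc_of_hasDerivAt_off_countable {x f : ℝ → Fin n → ℝ} {S : Set ℝ} (hS : S.Countable)
    (hx : Continuous x) (hd : ∀ t, 0 < t → t ∉ S → HasDerivAt x (f t) t)
    (hf : ∀ R, ∃ C, ∀ t ∈ Ioo 0 R, ‖f t‖ ≤ C) : W1InfLoc x := by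
  intro R hR
  obtain ⟨C, hC⟩ := hf R
  have hbd : ∀ t, t ∈ Ioo 0 R → t ∉ S → ‖deriv x t‖ ≤ C := fun t ht htS => by
    rw [(hd t ht.1 htS).deriv]
    exact hC t ht
  have hSae : ∀ᵐ t : ℝ, t ∉ S := (hS.ae_notMem volume)
  have hae : ∀ᵐ t ∂(volume.restrict (Ioo 0 R)), ‖deriv x t‖ ≤ C := by
    rw [ae_restrict_iff' measurableSet_Ioo]
    filter_upwards [hSae] with t ht hmem using hbd t hmem ht
  have hmem : MemLp (deriv x) ∞ (volume.restrict (Ioo 0 R)) :=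
    memLp_top_of_bound (stronglyMeasurable_deriv x).aestronglyMeasurable C hae
  refine ⟨?_, hmem⟩
  have hint : IntegrableOn (deriv x) (Ioo 0 R) := hmem.integrable (by simp)
  have hle : ∀ a b, 0 ≤ a → a ≤ b → b ≤ R → ‖x b - x a‖ ≤ C * |b - a| := by
    intro a b ha hab hb
    rw [← integral_eq_of_hasDerivAt_off_countable_of_le x (deriv x) hab hS hx.continuousOn]
    · refine intervalIntegral.norm_integral_le_of_norm_le_const_ae ?_
      have hne : ∀ᵐ t : ℝ, t ≠ b := by simp [ae_iff]
      filter_upwards [hSae, hne] with t ht htb hmem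
      rw [uIoc_of_le hab] at hmem
      exact hbd t ⟨ha.trans_lt hmem.1, (lt_of_le_of_ne hmem.2 htb).trans_le hb⟩ ht
    · intro t ht
      exact (hd t (ha.trans_lt ht.1.1) ht.2).differentiableAt.hasDerivAt
    · rw [intervalIntegrable_iff_integrableOn_Ioo_of_le hab]
      exact hint.mono_set (Ioo_subset_Ioo ha hb)
  have hlip : LipschitzOnWith C.toNNReal x (uIcc 0 R) := by
    rw [uIcc_of_le hR.le]
    refine LipschitzOnWith.of_dist_le_mul fun a ha b hb => ?_
    have hC' : C ≤ C.toNNReal := Real.le_coe_toNNReal C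
    rw [dist_comm, dist_comm a b, dist_eq_norm, Real.dist_eq]
    rcases le_total a b with h | h
    · exact (hle a b ha.1 h hb.2).trans (by gcongr)
    · rw [norm_sub_rev, abs_sub_comm]
      exact (hle b a hb.1 h ha.2).trans (by gcongr)
  exact hlip.absolutelyContinuousOnInterval

namespace Design
variable {p : Design n m} {A : Matrix (Fin n) (Fin n) ℝ} {B : Matrix (Fin n) (Fin m) ℝ} {T : ℝ}
  {y₀ : Fin n → ℝ}

/-- The dilated state `π = d(-r) y` along the explicit closed-loop orbit from `y₀`, as a function of
`r = ln (T - t)`. -/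
def phase (p : Design n m) (A : Matrix (Fin n) (Fin n) ℝ) (B : Matrix (Fin n) (Fin m) ℝ) (T : ℝ)
    (y₀ : Fin n → ℝ) (r : ℝ) : Fin n → ℝ :=
  NormedSpace.exp ((Real.log T - r) • (p.loop A B + p.Gd)) *ᵥ (p.dil (-Real.log T) *ᵥ y₀)

theorem hasDerivAt_phase (r : ℝ) : HasDerivAt (p.phase A B T y₀)
    (-((p.loop A B + p.Gd) *ᵥ p.phase A B T y₀ r)) r := by
  have h := hasDerivAt_exp_smul_mulVec (p.loop A B + p.Gd)
    ((hasDerivAt_id r).const_sub (Real.log T)) (hasDerivAt_const r (p.dil (-Real.log T) *ᵥ y₀))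
  refine h.congr_deriv ?_
  simp [phase]

/-- The flow of `A + B K₀ + B K + G_d` preserves the quadratic form of `X⁻¹`. -/
theorem Admissible.quadForm_phase (hp : p.Admissible A B) (r : ℝ) :
    quadForm p.X⁻¹ (p.phase A B T y₀ r) = p.wnorm T y₀ ^ 2 := by
  have hd : ∀ r, HasDerivAt (fun r => quadForm p.X⁻¹ (p.phase A B T y₀ r)) 0 r := by
    intro r
    refine (hasDerivAt_quadForm_comp p.X⁻¹ (hasDerivAt_phase r)).congr_deriv ?_
    rw [Matrix.mulVec_neg, neg_dotProduct, dotProduct_neg, ← neg_add, ← quadForm_mul_add,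
      Matrix.mul_add, Matrix.transpose_add, Matrix.add_mul, add_add_add_comm, hp.lyapunov_loop,
      ← dissip, neg_add_cancel]
    simp [quadForm]
  have h := is_const_of_deriv_eq_zero (fun r => (hd r).differentiableAt) (fun r => (hd r).deriv)
    r (Real.log T)
  rw [h, wnorm_eq, Real.sq_sqrt (quadForm_nonneg hp.posDef_inv _)]
  simp [phase]

theorem Admissible.exists_norm_sq_le (hp : p.Admissible A B) :
    ∃ C : ℝ, 0 < C ∧ ∀ v, ‖v‖ ^ 2 ≤ C * quadForm p.X⁻¹ v := by
  refine exists_le_mul_of_homogeneous (continuous_quadForm _) (by fun_prop) (quadForm_smul _) ?_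
    fun v hv => quadForm_pos hp.posDef_inv hv
  intro r v
  rw [norm_smul, mul_pow, Real.norm_eq_abs, sq_abs]

theorem Admissible.exists_norm_phase_le (hp : p.Admissible A B) (T : ℝ) (y₀ : Fin n → ℝ) :
    ∃ C, ∀ r, ‖p.phase A B T y₀ r‖ ≤ C := by
  obtain ⟨C, hC, h⟩ := hp.exists_norm_sq_le
  refine ⟨√(C * p.wnorm T y₀ ^ 2), fun r => Real.le_sqrt_of_sq_le ?_⟩
  exact (h _).trans (by rw [hp.quadForm_phase])

theorem Admissible.tendsto_dil_phase (hp : p.Admissible A B) (T : ℝ) (y₀ : Fin n → ℝ) :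
    Filter.Tendsto (fun r => p.dil r *ᵥ p.phase A B T y₀ r) Filter.atBot (nhds 0) := by
  obtain ⟨C, hC, h⟩ := hp.exists_norm_sq_le
  obtain ⟨c, hc, hdec⟩ := hp.exists_dil_decay
  rw [tendsto_zero_iff_norm_tendsto_zero]
  have h1 : Filter.Tendsto (fun r : ℝ => √(C * (Real.exp (c * r) * p.wnorm T y₀ ^ 2)))
      Filter.atBot (nhds 0) := by
    have h2 : Filter.Tendsto (fun r : ℝ => Real.exp (c * r)) Filter.atBot (nhds 0) :=
      Real.tendsto_exp_atBot.comp (Filter.tendsto_id.const_mul_atBot hc)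
    have h3 := ((h2.mul_const (p.wnorm T y₀ ^ 2)).const_mul C).sqrt
    simpa using h3
  refine squeeze_zero' (Filter.Eventually.of_forall fun r => norm_nonneg _) ?_ h1
  filter_upwards [Filter.eventually_le_atBot 0] with r hr
  refine Real.le_sqrt_of_sq_le ((h _).trans ?_)
  gcongr
  have h2 := hdec (p.phase A B T y₀ r) (-r) (by linarith)
  rwa [neg_neg, mul_neg, neg_neg, hp.quadForm_phase] at h2

/-- The explicit closed-loop orbit `y(t) = d(r) π(r)`, `r = ln (T - t)`, extended by `0` from `T`
on. -/
def orbit (p : Design n m) (A : Matrix (Fin n) (Fin n) ℝ) (B : Matrix (Fin n) (Fin m) ℝ) (T : ℝ)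
    (y₀ : Fin n → ℝ) (t : ℝ) : Fin n → ℝ :=
  if t < T then p.dil (Real.log (T - t)) *ᵥ p.phase A B T y₀ (Real.log (T - t)) else 0

/-- The control `K₀ y + K π` along `orbit`, and `0` outside `[0, T)`. -/
def orbitControl (p : Design n m) (A : Matrix (Fin n) (Fin n) ℝ) (B : Matrix (Fin n) (Fin m) ℝ)
    (T : ℝ) (y₀ : Fin n → ℝ) (t : ℝ) : Fin m → ℝ :=
  if 0 ≤ t ∧ t < T then p.K₀ *ᵥ p.orbit A B T y₀ t + p.K *ᵥ p.phase A B T y₀ (Real.log (T - t))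
  else 0

theorem orbit_of_le {t : ℝ} (h : T ≤ t) : p.orbit A B T y₀ t = 0 := if_neg h.not_gt

theorem orbit_of_lt {t : ℝ} (h : t < T) : p.orbit A B T y₀ t =
    p.dil (Real.log (T - t)) *ᵥ p.phase A B T y₀ (Real.log (T - t)) := if_pos h

theorem orbit_zero (hT : 0 < T) : p.orbit A B T y₀ 0 = y₀ := by
  rw [orbit_of_lt hT, sub_zero, phase, sub_self, zero_smul, NormedSpace.exp_zero,
    Matrix.one_mulVec, dil_dil, add_neg_cancel, dil_zero, Matrix.one_mulVec]

theorem Admissible.hasDerivAt_orbit (hp : p.Admissible A B) {t : ℝ} (ht : t < T) :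
    HasDerivAt (p.orbit A B T y₀) (A *ᵥ p.orbit A B T y₀ t + B *ᵥ (p.K₀ *ᵥ p.orbit A B T y₀ t +
      p.K *ᵥ p.phase A B T y₀ (Real.log (T - t)))) t := by
  have hpos : 0 < T - t := sub_pos.2 ht
  have hr : HasDerivAt (fun t => Real.log (T - t)) (-(T - t)⁻¹) t := by
    simpa [div_eq_mul_inv] using ((hasDerivAt_id t).const_sub T).log hpos.ne'
  have hph : HasDerivAt (fun t => p.phase A B T y₀ (Real.log (T - t)))
      (-(T - t)⁻¹ • -((p.loop A B + p.Gd) *ᵥ p.phase A B T y₀ (Real.log (T - t)))) t :=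
    HasDerivAt.scomp t (hasDerivAt_phase _) hr
  have h1 := hasDerivAt_exp_smul_mulVec p.Gd hr hph
  refine (h1.congr_of_eventuallyEq ?_).congr_deriv ?_
  · filter_upwards [Iio_mem_nhds ht] with s hs using orbit_of_lt hs
  · rw [orbit_of_lt ht]
    change -(T - t)⁻¹ • (p.Gd *ᵥ (p.dil (Real.log (T - t)) *ᵥ _)) +
      p.dil (Real.log (T - t)) *ᵥ _ = _
    have hE : Real.exp (Real.log (T - t)) = T - t := Real.exp_log hpos
    have h2 := hp.dil_mul_A₀ (Real.log (T - t))
    have h3 := hp.dil_mul_B (Real.log (T - t))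
    have h4 : p.Gd * p.dil (Real.log (T - t)) = p.dil (Real.log (T - t)) * p.Gd := by
      rw [dil]
      exact (exp_mul_intertwine (by simp)).symm
    rw [hE] at h2 h3
    generalize p.phase A B T y₀ (Real.log (T - t)) = v at *
    generalize p.dil (Real.log (T - t)) = E at *
    have h5 : E * p.loop A B = (T - t) • ((A + B * p.K₀) * E + B * p.K) := by
      rw [loop, Matrix.mul_add, h2, ← Matrix.mul_assoc, h3, Matrix.smul_mul, smul_add]
    have h6 : E *ᵥ (-(T - t)⁻¹ • -((p.loop A B + p.Gd) *ᵥ v)) =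
        ((A + B * p.K₀) * E + B * p.K) *ᵥ v + (T - t)⁻¹ • (E *ᵥ (p.Gd *ᵥ v)) := by
      rw [neg_smul, smul_neg, neg_neg, Matrix.mulVec_smul, Matrix.mulVec_mulVec, Matrix.mul_add, h5,
        Matrix.add_mulVec, smul_add, Matrix.smul_mulVec, smul_smul, inv_mul_cancel₀ hpos.ne',
        one_smul, Matrix.mulVec_mulVec]
    rw [h6, Matrix.mulVec_mulVec, Matrix.mulVec_mulVec, h4]
    simp only [Matrix.add_mulVec, Matrix.add_mul, Matrix.mulVec_add, Matrix.mulVec_mulVec,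
      Matrix.mul_assoc, neg_smul]
    abel

theorem Admissible.continuous_orbit (hp : p.Admissible A B) : Continuous (p.orbit A B T y₀) := by
  rw [continuous_iff_continuousAt]
  intro t
  rcases lt_trichotomy t T with h | rfl | h
  · exact (hp.hasDerivAt_orbit h).continuousAt
  · rw [continuousAt_iff_continuous_left'_right']
    constructor
    · have h1 : Filter.Tendsto (fun s => Real.log (t - s)) (nhdsWithin t (Iio t)) Filter.atBot := by
        refine Real.tendsto_log_nhdsGT_zero.comp (tendsto_nhdsWithin_iff.2 ⟨?_, ?_⟩)
        · have : Filter.Tendsto (fun s => t - s) (nhds t) (nhds (t - t)) :=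
            (continuous_const.sub continuous_id).tendsto t
          rw [sub_self] at this
          exact this.mono_left nhdsWithin_le_nhds
        · filter_upwards [self_mem_nhdsWithin] with s hs using mem_Ioi.2 (sub_pos.2 (mem_Iio.1 hs))
      rw [ContinuousWithinAt, orbit_of_le le_rfl]
      refine ((hp.tendsto_dil_phase t y₀).comp h1).congr' ?_
      filter_upwards [self_mem_nhdsWithin] with s hs using (orbit_of_lt hs).symm
    · rw [ContinuousWithinAt, orbit_of_le le_rfl]
      refine tendsto_const_nhds.congr' ?_
      filter_upwards [self_mem_nhdsWithin] with s hs using (orbit_of_le (le_of_lt hs)).symm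
  · refine continuousAt_const.congr (f := fun _ => 0) ?_
    filter_upwards [Ioi_mem_nhds h] with s hs using (orbit_of_le (le_of_lt hs)).symm

theorem Admissible.orbitControl_eq_uct (hp : p.Admissible A B) (hy₀ : y₀ ≠ 0) {t : ℝ}
    (ht : 0 ≤ t) (htT : t < T) :
    p.orbitControl A B T y₀ t = p.uct T (p.orbit A B T y₀ t) y₀ := by
  have hT : 0 < T := ht.trans_lt htT
  have hpos : 0 < T - t := sub_pos.2 htT
  have hρ := hp.wnorm_pos T hy₀
  set r := Real.log (T - t) with hr
  -- This identifies `‖y / ‖y₀‖‖_d = e^{r - ln T} = (T - t) / T`.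
  have hlev : p.level T (r - Real.log T) ((p.wnorm T y₀)⁻¹ • p.orbit A B T y₀ t) = 1 := by
    rw [level, sub_add_cancel, dil_mulVec_smul, orbit_of_lt htT, dil_dil, neg_add_cancel, dil_zero,
      Matrix.one_mulVec, quadForm_smul, hp.quadForm_phase, ← mul_pow, inv_mul_cancel₀ hρ.ne',
      one_pow]
  rw [orbitControl, if_pos ⟨ht, htT⟩, uct, if_neg hy₀, hp.homNorm_eq_exp hlev,
    min_eq_right, Real.log_exp, Matrix.mul_assoc, ← dil_add]
  · rw [show -Real.log T + -(r - Real.log T) = -r by ring, ← Matrix.mulVec_mulVec]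
    conv_rhs => rw [orbit_of_lt htT]
    rw [dil_dil, ← hr, neg_add_cancel, dil_zero, Matrix.one_mulVec, orbit_of_lt htT]
  · rw [← Real.exp_zero, Real.exp_le_exp, sub_nonpos]
    exact Real.log_le_log hpos (by linarith)

theorem orbit_ne_zero (hy₀ : y₀ ≠ 0) {t : ℝ} (htT : t < T) :
    p.orbit A B T y₀ t ≠ 0 := by
  rw [orbit_of_lt htT]
  exact dil_mulVec_ne_zero _ (exp_smul_mulVec_ne_zero _ (dil_mulVec_ne_zero _ hy₀))

theorem Admissible.orbitControl_mem_uctBar (hp : p.Admissible A B) (hy₀ : y₀ ≠ 0) {t : ℝ}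
    (ht : 0 ≤ t) : p.orbitControl A B T y₀ t ∈ p.uctBar T (p.orbit A B T y₀ t) y₀ := by
  rcases lt_or_ge t T with h | h
  · exact Or.inl ⟨orbit_ne_zero hy₀ h, hp.orbitControl_eq_uct hy₀ ht h⟩
  · refine Or.inr ⟨orbit_of_le h, 0, by simp [wnorm_zero], ?_⟩
    rw [orbitControl, if_neg fun h' => h.not_gt h'.2]
    simp

theorem Admissible.exists_norm_orbitControl_le (hp : p.Admissible A B) :
    ∃ C, ∀ t, ‖p.orbitControl A B T y₀ t‖ ≤ C := by
  obtain ⟨C₁, h₁⟩ := hp.exists_norm_phase_le T y₀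
  obtain ⟨C₂, h₂⟩ := (isCompact_Icc (a := 0) (b := T)).exists_bound_of_continuousOn
    (f := fun t => p.K₀ *ᵥ p.orbit A B T y₀ t)
    (continuous_const.matrix_mulVec hp.continuous_orbit).continuousOn
  obtain ⟨C₃, h₃⟩ := (isCompact_closedBall (0 : Fin n → ℝ) C₁).exists_bound_of_continuousOn
    (f := fun v => p.K *ᵥ v) (continuous_const.matrix_mulVec continuous_id).continuousOn
  refine ⟨max (C₂ + C₃) 0, fun t => ?_⟩
  rw [orbitControl]
  split_ifs with h
  · refine le_max_of_le_left ((norm_add_le _ _).trans (add_le_add (h₂ t ⟨h.1, h.2.le⟩) (h₃ _ ?_)))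
    simpa using h₁ _
  · simp

theorem Admissible.measurable_orbitControl (hp : p.Admissible A B) :
    Measurable (p.orbitControl A B T y₀) := by
  refine Measurable.ite measurableSet_Ico ?_ measurable_const
  have h1 : Continuous (p.phase A B T y₀) :=
    continuous_iff_continuousAt.2 fun r => (hasDerivAt_phase r).continuousAt
  have h2 : Measurable fun t => Real.log (T - t) :=
    Real.measurable_log.comp (measurable_const.sub measurable_id)
  have h3 : Continuous fun v : Fin n → ℝ => p.K *ᵥ v := by fun_prop
  exact (continuous_const.matrix_mulVec hp.continuous_orbit).measurable.add
    ((h3.comp h1).measurable.comp h2)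

end Design

theorem isSolution_zero (p : Design n m) (A : Matrix (Fin n) (Fin n) ℝ)
    (B : Matrix (Fin n) (Fin m) ℝ) (T τ : ℝ) :
    IsSolution A B p T τ 0 0 (fun _ => 0) (fun _ => 0) fun _ => 0 := by
  have h0 : W1InfLoc fun _ : ℝ => (0 : Fin n → ℝ) :=
    w1InfLoc_of_hasDerivAt_off_countable (f := fun _ => 0) countable_empty continuous_const
      (fun t _ _ => hasDerivAt_const t _) fun R => ⟨0, by simp⟩
  refine ⟨h0, h0, fun R => MemLp.zero, ?_, rfl, ?_, ?_, ?_⟩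
  · exact Filter.Eventually.of_forall fun t => by simpa using hasDerivAt_const t (0 : Fin n → ℝ)
  · exact Filter.Eventually.of_forall fun t => rfl
  · intro t ht
    simp
  · exact Filter.Eventually.of_forall fun t =>
      Or.inr ⟨rfl, 0, by simp [Design.wnorm_zero], by simp⟩

theorem exists_isSolution {p : Design n m} {A : Matrix (Fin n) (Fin n) ℝ}
    {B : Matrix (Fin n) (Fin m) ℝ} (hp : p.Admissible A B) {T τ : ℝ} (hT : 0 < T) (hτ : 0 < τ)
    (x₀ : Fin n → ℝ) : ∃ x y u, IsSolution A B p T τ 0 x₀ x y u := by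
  rcases eq_or_ne x₀ 0 with rfl | hx₀
  · exact ⟨_, _, _, isSolution_zero p A B T τ⟩
  set y₀ := NormedSpace.exp (τ • A) *ᵥ x₀ with hy₀def
  have hy₀ : y₀ ≠ 0 := exp_smul_mulVec_ne_zero τ hx₀
  set u := p.orbitControl A B T y₀ with hu
  -- The free motion up to time `τ`, followed by the orbit of the predictor, delayed by `τ`.
  set x : ℝ → Fin n → ℝ := fun t =>
    if t ≤ τ then NormedSpace.exp (t • A) *ᵥ x₀ else p.orbit A B T y₀ (t - τ) with hx
  have hx_le : ∀ t, t ≤ τ → x t = NormedSpace.exp (t • A) *ᵥ x₀ := fun t ht => if_pos ht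
  have hx_ge : ∀ t, τ ≤ t → x t = p.orbit A B T y₀ (t - τ) := by
    intro t ht
    rcases ht.eq_or_lt with rfl | h
    · rw [hx_le _ le_rfl, sub_self, Design.orbit_zero hT]
    · exact if_neg h.not_ge
  have hxc : Continuous x := by
    refine Continuous.if_le ((continuous_exp_smul A).matrix_mulVec continuous_const)
      (hp.continuous_orbit.comp (continuous_id.sub continuous_const)) continuous_id
      continuous_const ?_
    intro t ht
    rw [ht]
    simp [Design.orbit_zero hT, hy₀def]
  have hu_neg : ∀ t, t < 0 → u t = 0 := fun t ht => if_neg fun h => ht.not_ge h.1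
  have hd : ∀ t, t ∉ ({τ, T + τ} : Set ℝ) → HasDerivAt x (A *ᵥ x t + B *ᵥ u (t - τ)) t := by
    intro t ht
    simp only [mem_insert_iff, mem_singleton_iff, not_or] at ht
    rcases lt_or_gt_of_ne ht.1 with h | h
    · have h1 := hasDerivAt_exp_smul_mulVec A (hasDerivAt_id t) (hasDerivAt_const t x₀)
      rw [hu_neg _ (by linarith), hx_le t h.le]
      refine (h1.congr_of_eventuallyEq ?_).congr_deriv (by simp)
      filter_upwards [Iio_mem_nhds h] with s hs using hx_le s (le_of_lt hs)
    · have hev : x =ᶠ[nhds t] fun s => p.orbit A B T y₀ (s - τ) := by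
        filter_upwards [Ioi_mem_nhds h] with s hs using hx_ge s (le_of_lt hs)
      rw [hx_ge t h.le]
      rcases lt_or_gt_of_ne ht.2 with h' | h'
      · have h1 := hp.hasDerivAt_orbit (y₀ := y₀) (show t - τ < T by linarith)
        rw [hu, Design.orbitControl, if_pos ⟨by linarith, by linarith⟩]
        exact (h1.comp_sub_const t τ).congr_of_eventuallyEq hev
      · rw [hu, Design.orbitControl, if_neg fun h2 => by linarith [h2.2],
          Design.orbit_of_le (by linarith)]
        refine ((hasDerivAt_const t 0).congr_of_eventuallyEq ?_).congr_deriv (by simp)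
        filter_upwards [hev, Ioi_mem_nhds h'] with s hs hs'
        rw [hs, Design.orbit_of_le (by linarith [mem_Ioi.1 hs'])]
  have hS : ({τ, T + τ} : Set ℝ).Countable := (Set.toFinite _).countable
  obtain ⟨Cu, hCu⟩ := hp.exists_norm_orbitControl_le (T := T) (y₀ := y₀)
  have hbound : ∀ R, ∃ C, ∀ t ∈ Icc 0 R, ‖A *ᵥ x t + B *ᵥ u (t - τ)‖ ≤ C := by
    intro R
    obtain ⟨C₁, h₁⟩ := (isCompact_Icc (a := 0) (b := R)).exists_bound_of_continuousOn
      (f := fun t => A *ᵥ x t) (continuous_const.matrix_mulVec hxc).continuousOn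
    obtain ⟨C₂, h₂⟩ := (isCompact_closedBall (0 : Fin m → ℝ) Cu).exists_bound_of_continuousOn
      (f := fun v => B *ᵥ v) (continuous_const.matrix_mulVec continuous_id).continuousOn
    refine ⟨C₁ + C₂, fun t ht => (norm_add_le _ _).trans (add_le_add (h₁ t ht) (h₂ _ ?_))⟩
    simpa using hCu _
  have hW : W1InfLoc x := w1InfLoc_of_hasDerivAt_off_countable hS hxc (fun t _ => hd t) fun R =>
    (hbound R).imp fun C hC t ht => hC t ⟨ht.1.le, ht.2.le⟩
  have hplant : ∀ᵐ t ∂(volume.restrict (Ioi (0 : ℝ))),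
      HasDerivAt x (A *ᵥ x t + B *ᵥ u (t - τ)) t :=
    ae_restrict_of_ae ((hS.ae_notMem volume).mono hd)
  have hy : ∀ t, 0 ≤ t → x (t + τ) = p.orbit A B T y₀ t := fun t ht => by
    rw [hx_ge _ (by linarith), add_sub_cancel_right]
  refine ⟨x, fun t => x (t + τ), u, hW, ?_, ?_, hplant, ?_, ?_, ?_, ?_⟩
  · refine w1InfLoc_of_hasDerivAt_off_countable (S := (· + τ) ⁻¹' {τ, T + τ})
      (hS.preimage (add_left_injective τ)) (hxc.comp (continuous_id.add continuous_const))
      (fun t _ ht => (hd (t + τ) ht).comp_add_const t τ) fun R => ?_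
    obtain ⟨C, hC⟩ := hbound (R + τ)
    exact ⟨C, fun t ht => hC _ ⟨by linarith [ht.1], by linarith [ht.2]⟩⟩
  · intro R
    exact memLp_top_of_bound hp.measurable_orbitControl.aestronglyMeasurable Cu
      (Filter.Eventually.of_forall hCu)
  · rw [hx_le 0 hτ.le]
    simp
  · filter_upwards [ae_restrict_mem measurableSet_Ioo] with t ht using hu_neg t ht.2
  · intro t ht
    exact predictor_eq hτ.le ht hW hplant
  · filter_upwards [ae_restrict_mem measurableSet_Ioi] with t ht
    rw [hy t (le_of_lt ht), hy 0 le_rfl, Design.orbit_zero hT]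
    exact hp.orbitControl_mem_uctBar hy₀ (le_of_lt ht)

end DelayControl

end

theorem mainTheorem5 {n m : ℕ} (A : Matrix (Fin n) (Fin n) ℝ) (B : Matrix (Fin n) (Fin m) ℝ)
    (hAB : DelayControl.Controllable A B) (p : DelayControl.Design n m) (hp : p.Admissible A B)
    (T τ : ℝ) (hT : 0 < T) (hτ : 0 < τ) :
    -- for every initial state the closed loop (with zero initial control) has a solution
    (∀ x₀ : Fin n → ℝ, ∃ x y u, DelayControl.IsSolution A B p T τ 0 x₀ x y u) ∧
    -- Lyapunov stability
    (∃ α : ℝ → ℝ, DelayControl.ClassK α ∧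
      ∀ x₀ x y u, DelayControl.IsSolution A B p T τ 0 x₀ x y u →
        ∀ t : ℝ, 0 ≤ t → p.wnorm T (x t) ≤ α (p.wnorm T x₀)) ∧
    -- the settling time is exactly `T + τ`
    (∀ x₀ x y u, DelayControl.IsSolution A B p T τ 0 x₀ x y u →
      (∀ t : ℝ, T + τ ≤ t → x t = 0) ∧
      (x₀ ≠ 0 → ∀ t : ℝ, 0 ≤ t → t < T + τ → x t ≠ 0)) := by
  refine ⟨DelayControl.exists_isSolution hp hT hτ, ?_, ?_⟩
  · obtain ⟨C, hC, hle⟩ := hp.exists_wnorm_exp_le T τ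
    refine ⟨fun r => C * r, ⟨by fun_prop, ?_, mul_zero C⟩, fun x₀ x y u h t ht => ?_⟩
    · exact fun a _ b _ hab => mul_lt_mul_of_pos_left hab hC
    · rcases le_total t τ with htτ | htτ
      · rw [h.x_eq_exp ht htτ]
        exact hle t ⟨ht, htτ⟩ x₀
      · have hy : x t = y (t - τ) := by
          rw [h.y_eq_shift hτ.le (sub_nonneg.2 htτ), sub_add_cancel]
        refine le_trans ?_ (hle τ ⟨hτ.le, le_rfl⟩ x₀)
        rw [hy, ← h.y_zero hτ.le]
        by_cases h0 : y 0 = 0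
        · rw [h.y_eq_zero hτ.le h0 (sub_nonneg.2 htτ), h0]
        · exact (h.y_trajectory hp hT hτ.le h0 (sub_nonneg.2 htτ)).1
  · intro x₀ x y u h
    refine ⟨fun t ht => ?_, fun hx₀ t ht htT => ?_⟩
    · have hs : 0 ≤ t - τ := by linarith
      have hy : x t = y (t - τ) := by rw [h.y_eq_shift hτ.le hs, sub_add_cancel]
      rw [hy]
      by_cases h0 : y 0 = 0
      · exact h.y_eq_zero hτ.le h0 hs
      · exact (h.y_trajectory hp hT hτ.le h0 hs).2.2 (by linarith)
    · rcases le_total t τ with htτ | htτ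
      · rw [h.x_eq_exp ht htτ]
        exact DelayControl.exp_smul_mulVec_ne_zero t hx₀
      · have hs : 0 ≤ t - τ := sub_nonneg.2 htτ
        have hy : x t = y (t - τ) := by rw [h.y_eq_shift hτ.le hs, sub_add_cancel]
        have h0 : y 0 ≠ 0 := by
          rw [h.y_zero hτ.le]
          exact DelayControl.exp_smul_mulVec_ne_zero τ hx₀
        rw [hy]
        intro hzero
        linarith [(h.y_trajectory hp hT hτ.le h0 hs).2.1 hzero]
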